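/- Let $\ell\in\{0,1,2,\ldots\}\cup\{\infty\}$, let $d\geq 1$ be an integer, let $m\in\{0,\ldots,d\}$, and let $F$ be a Hausdorff locally convex real topological vector space (not assumed complete). For a subset $R\subseteq\mathbb{R}^d$ which is contained in the closure of its interior $R^0$, let $C^\ell(R,F)$ be the vector space of all continuous functions $\gamma\colon R\to F$ such that, for each multi-index $\alpha\in\{0,1,2,\ldots\}^d$ with $|\alpha|\leq\ell$, the partial derivative $\partial^\alpha(\gamma|_{R^0})\colon R^0\to F$ exists and extends to a (necessarily unique) continuous function $\partial^\alpha\gamma\colon R\to F$. Endow $C^\ell(R,F)$ with the initial topology with respect to the maps $\gamma\mapsto\partial^\alpha\gamma$ to $C(R,F)$ for $|\alpha|\leq\ell$, where the space $C(R,F)$ of continuous functions carries the compact-open topology. Then the restriction map \[ C^\ell(\mathbb{R}^d,F)\to C^\ell([0,\infty[^m\times\mathbb{R}^{d-m},F),\quad \gamma\mapsto\gamma|_{[0,\infty[^m\times\mathbb{R}^{d-m}} \] has a continuous linear right inverse. Moreover, the restriction map \[ C^\ell(\mathbb{R}^d,F)\to C^\ell([0,1]^d,F),\quad \gamma\mapsto\gamma|_{[0,1]^d}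 \] has a continuous linear right inverse. -/

import Mathlib

open Set Filter Topology

noncomputable section

/-- The partial derivative `∂f/∂xᵢ` of `f : ℝᵈ → F` at the point `x` exists and equals `v`: the
difference quotients `t⁻¹ (f (x + t eᵢ) - f x)` converge to `v` as `t → 0`, `t ≠ 0`. -/
def HasPartialDerivAt {d : ℕ} {F : Type*} [AddCommGroup F] [Module ℝ F] [TopologicalSpace F]
    (f : (Fin d → ℝ) → F) (i : Fin d) (x : Fin d → ℝ) (v : F) : Prop :=
  Tendsto (fun t : ℝ => t⁻¹ • (f (x + t • Pi.single i 1) - f x)) (𝓝[≠] 0) (𝓝 v)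

/-- `HasIterPartialOn U [i₁, …, iₖ] f g`, for an open set `U ⊆ ℝᵈ`: the iterated partial derivative
`∂_{i₁} (⋯ (∂_{iₖ} f))` exists on `U` and is equal to `g` there. (Only the values of `f` and `g`
on `U` matter.) -/
def HasIterPartialOn {d : ℕ} {F : Type*} [AddCommGroup F] [Module ℝ F] [TopologicalSpace F]
    (U : Set (Fin d → ℝ)) : List (Fin d) → ((Fin d → ℝ) → F) → ((Fin d → ℝ) → F) → Prop
  | [], f, g => ∀ x ∈ U, g x = f x
  | i :: w, f, g => ∃ h : (Fin d → ℝ) → F,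
      HasIterPartialOn U w f h ∧ ∀ x ∈ U, HasPartialDerivAt h i x (g x)

/-- The list `1, …, 1, 2, …, 2, …, d, …, d` in which `i` occurs `αᵢ` times. -/
def multiIndexWord {d : ℕ} (α : Fin d → ℕ) : List (Fin d) :=
  (List.finRange d).flatMap fun i => List.replicate (α i) i

/-- On the open set `U`, the derivative `∂^α f = (∂/∂x₁)^α₁ ⋯ (∂/∂x_d)^α_d f` exists
and is equal to `g`. -/
def HasMultiPartialOn {d : ℕ} {F : Type*} [AddCommGroup F] [Module ℝ F] [TopologicalSpace F]
    (U : Set (Fin d → ℝ)) (α : Fin d → ℕ) (f g : (Fin d → ℝ) → F) : Prop :=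
  HasIterPartialOn U (multiIndexWord α) f g

/-- A function on a subset `R` of `ℝᵈ`, extended by `0` to a function on `ℝᵈ`. It is used only to
speak about the values near interior points of `R`, where the choice of `0` plays no role. -/
def zeroExt {d : ℕ} {F : Type*} [Zero F] {R : Set (Fin d → ℝ)} (γ : R → F) : (Fin d → ℝ) → F :=
  Function.extend Subtype.val γ 0

theorem zeroExt_apply {d : ℕ} {F : Type*} [Zero F] {R : Set (Fin d → ℝ)} (γ : R → F)
    {x : Fin d → ℝ} (hx : x ∈ R) : zeroExt γ x = γ ⟨x, hx⟩ :=
  Subtype.val_injective.extend_apply γ 0 ⟨x, hx⟩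

section Partial

variable {d : ℕ} {F : Type*} [AddCommGroup F] [Module ℝ F] [TopologicalSpace F]

theorem HasIterPartialOn.congr_mono {U V : Set (Fin d → ℝ)} {w : List (Fin d)}
    {f f' g g' : (Fin d → ℝ) → F} (h : HasIterPartialOn V w f g) (hUV : U ⊆ V)
    (hf : ∀ x ∈ U, f x = f' x) (hg : ∀ x ∈ U, g x = g' x) : HasIterPartialOn U w f' g' := by
  induction w generalizing g g' with
  | nil => exact fun x hx => by rw [← hg x hx, h x (hUV hx), hf x hx]
  | cons i w ih =>
    obtain ⟨k, hk, hk'⟩ := h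
    exact ⟨k, ih hk fun _ _ => rfl, fun x hx => hg x hx ▸ hk' x (hUV hx)⟩

/-- Iterated partial derivatives on an open set are unique. -/
theorem HasIterPartialOn.unique [T2Space F] {U : Set (Fin d → ℝ)} (hU : IsOpen U)
    {w : List (Fin d)} {f g g' : (Fin d → ℝ) → F} (h : HasIterPartialOn U w f g)
    (h' : HasIterPartialOn U w f g') : ∀ x ∈ U, g x = g' x := by
  induction w generalizing g g' with
  | nil => exact fun x hx => (h x hx).trans (h' x hx).symm
  | cons i w ih =>
    obtain ⟨k, hk, hk'⟩ := h
    obtain ⟨l, hl, hl'⟩ := h'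
    intro x hx
    have hkl := ih hk hl
    have hpath : Tendsto (fun t : ℝ => x + t • (Pi.single i 1 : Fin d → ℝ)) (𝓝[≠] 0) (𝓝 x) := by
      have hc : Continuous fun t : ℝ => x + t • (Pi.single i 1 : Fin d → ℝ) := by fun_prop
      have := hc.tendsto 0
      simp only [zero_smul, add_zero] at this
      exact this.mono_left nhdsWithin_le_nhds
    refine tendsto_nhds_unique (hk' x hx) ((hl' x hx).congr' ?_)
    filter_upwards [hpath (hU.mem_nhds hx)] with t ht
    rw [hkl _ ht, hkl x hx]

theorem HasIterPartialOn.zero (U : Set (Fin d → ℝ)) (w : List (Fin d)) :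
    HasIterPartialOn U w (fun _ => (0 : F)) (fun _ => 0) := by
  induction w with
  | nil => exact fun _ _ => rfl
  | cons i w ih => exact ⟨_, ih, fun x _ => by simp [HasPartialDerivAt, tendsto_const_nhds]⟩

theorem HasIterPartialOn.add [IsTopologicalAddGroup F] {U : Set (Fin d → ℝ)} {w : List (Fin d)}
    {f₁ f₂ g₁ g₂ : (Fin d → ℝ) → F} (h₁ : HasIterPartialOn U w f₁ g₁)
    (h₂ : HasIterPartialOn U w f₂ g₂) :
    HasIterPartialOn U w (fun x => f₁ x + f₂ x) (fun x => g₁ x + g₂ x) := by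
  induction w generalizing g₁ g₂ with
  | nil => exact fun x hx => congrArg₂ (· + ·) (h₁ x hx) (h₂ x hx)
  | cons i w ih =>
    obtain ⟨k₁, hk₁, hk₁'⟩ := h₁
    obtain ⟨k₂, hk₂, hk₂'⟩ := h₂
    refine ⟨_, ih hk₁ hk₂, fun x hx => ((hk₁' x hx).add (hk₂' x hx)).congr fun t => ?_⟩
    rw [← smul_add]
    exact congrArg (t⁻¹ • ·) (sub_add_sub_comm _ _ _ _)

theorem HasIterPartialOn.smul [ContinuousSMul ℝ F] {U : Set (Fin d → ℝ)} {w : List (Fin d)}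
    {f g : (Fin d → ℝ) → F} (c : ℝ) (h : HasIterPartialOn U w f g) :
    HasIterPartialOn U w (fun x => c • f x) (fun x => c • g x) := by
  induction w generalizing g with
  | nil => exact fun x hx => congrArg (c • ·) (h x hx)
  | cons i w ih =>
    obtain ⟨k, hk, hk'⟩ := h
    refine ⟨_, ih hk, fun x hx => ((hk' x hx).const_smul c).congr fun t => ?_⟩
    rw [smul_comm, smul_sub]

end Partial

/-- The continuous function `g` on `R` extends the partial derivative `∂^α (γ|_{R⁰})`, which exists
on the whole interior `R⁰` of `R`. -/
def IsPartialExtension {d : ℕ} {F : Type*} [AddCommGroup F] [Module ℝ F] [TopologicalSpace F]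
    {R : Set (Fin d → ℝ)} (α : Fin d → ℕ) (γ g : C(R, F)) : Prop :=
  HasMultiPartialOn (interior R) α (zeroExt γ) (zeroExt g)

section Ck

variable {d : ℕ} (ℓ : ℕ∞) (R : Set (Fin d → ℝ)) (F : Type*) [AddCommGroup F] [Module ℝ F]
  [TopologicalSpace F] [IsTopologicalAddGroup F] [ContinuousSMul ℝ F]

/-- The vector subspace of `C(R, F)` of all continuous functions `γ : R → F` such that, for all
multi-indices `α` with `|α| ≤ ℓ`, the derivative `∂^α (γ|_{R⁰})` exists and has a continuous
extension to `R`. -/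
def ckSubmodule : Submodule ℝ C(R, F) where
  carrier := {γ | ∀ α : Fin d → ℕ, ((∑ i, α i : ℕ) : ℕ∞) ≤ ℓ →
    ∃ g : C(R, F), IsPartialExtension α γ g}
  zero_mem' := fun α _ => ⟨0, (HasIterPartialOn.zero (interior R) (multiIndexWord α)).congr_mono
    Subset.rfl (fun x hx => by rw [zeroExt_apply _ (interior_subset hx)]; rfl)
    (fun x hx => by rw [zeroExt_apply _ (interior_subset hx)]; rfl)⟩
  add_mem' := by
    intro γ η hγ hη α hα
    obtain ⟨g, hg⟩ := hγ α hα
    obtain ⟨k, hk⟩ := hη α hα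
    refine ⟨g + k, (HasIterPartialOn.add hg hk).congr_mono Subset.rfl ?_ ?_⟩ <;>
    · intro x hx
      simp only [zeroExt_apply _ (interior_subset hx)]
      rfl
  smul_mem' := by
    intro c γ hγ α hα
    obtain ⟨g, hg⟩ := hγ α hα
    refine ⟨c • g, (HasIterPartialOn.smul c hg).congr_mono Subset.rfl ?_ ?_⟩ <;>
    · intro x hx
      simp only [zeroExt_apply _ (interior_subset hx)]
      rfl

/-- The space `C^ℓ(R, F)`, for `ℓ ∈ ℕ₀ ∪ {∞}` and a subset `R` of `ℝᵈ` with dense interior. Its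
topology is the compact-open `C^ℓ`-topology defined below (not the subspace topology of
`C(R, F)`). -/
def CkMap : Type _ := ckSubmodule ℓ R F

end Ck

namespace CkMap

variable {d : ℕ} {ℓ : ℕ∞} {R S : Set (Fin d → ℝ)} {F : Type*} [AddCommGroup F] [Module ℝ F]
  [TopologicalSpace F] [IsTopologicalAddGroup F] [ContinuousSMul ℝ F]

instance : AddCommGroup (CkMap ℓ R F) := inferInstanceAs (AddCommGroup (ckSubmodule ℓ R F))

instance : Module ℝ (CkMap ℓ R F) := inferInstanceAs (Module ℝ (ckSubmodule ℓ R F))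

/-- The underlying continuous function `R → F`, as a linear map. -/
def toContinuousMap : CkMap ℓ R F →ₗ[ℝ] C(R, F) := (ckSubmodule ℓ R F).subtype

/-- The continuous function `∂^α γ : R → F`, for `|α| ≤ ℓ`. -/
def partialDeriv (α : Fin d → ℕ) (hα : ((∑ i, α i : ℕ) : ℕ∞) ≤ ℓ) (γ : CkMap ℓ R F) : C(R, F) :=
  Classical.choose (γ.2 α hα)

theorem partialDeriv_spec (α : Fin d → ℕ) (hα : ((∑ i, α i : ℕ) : ℕ∞) ≤ ℓ) (γ : CkMap ℓ R F) :
    IsPartialExtension α γ.toContinuousMap (γ.partialDeriv α hα) :=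
  Classical.choose_spec (γ.2 α hα)

/-- If the interior of `R` is dense in `R`, then `∂^α γ` is the only continuous extension. -/
theorem partialDeriv_unique [T2Space F] (hR : R ⊆ closure (interior R)) (α : Fin d → ℕ)
    (hα : ((∑ i, α i : ℕ) : ℕ∞) ≤ ℓ) (γ : CkMap ℓ R F) {g : C(R, F)}
    (hg : IsPartialExtension α γ.toContinuousMap g) : g = γ.partialDeriv α hα := by
  have h := HasIterPartialOn.unique isOpen_interior hg (γ.partialDeriv_spec α hα)
  have hd : Dense ((Subtype.val : R → (Fin d → ℝ)) ⁻¹' interior R) := by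
    rw [Subtype.dense_iff]
    intro x hx
    rw [Subtype.image_preimage_coe, inter_eq_right.2 interior_subset]
    exact hR hx
  refine DFunLike.coe_injective (g.continuous.ext_on hd (γ.partialDeriv α hα).continuous ?_)
  intro x hx
  have := h x hx
  rwa [zeroExt_apply _ x.2, zeroExt_apply _ x.2] at this

/-- The compact-open `C^ℓ`-topology: the initial topology with respect to the maps
`∂^α : C^ℓ(R, F) → C(R, F)` for `|α| ≤ ℓ`, where `C(R, F)` carries the compact-open topology. -/
instance : TopologicalSpace (CkMap ℓ R F) :=
  ⨅ (α : Fin d → ℕ) (hα : ((∑ i, α i : ℕ) : ℕ∞) ≤ ℓ),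
    TopologicalSpace.induced (fun γ : CkMap ℓ R F => γ.partialDeriv α hα)
      ContinuousMap.compactOpen

/-- The restriction map `C^ℓ(S, F) → C^ℓ(R, F)`, `γ ↦ γ|_R`, for `R ⊆ S`. -/
def restrict (h : R ⊆ S) : CkMap ℓ S F →ₗ[ℝ] CkMap ℓ R F where
  toFun γ := ⟨γ.toContinuousMap.comp ⟨inclusion h, continuous_inclusion h⟩, fun α hα =>
    ⟨(γ.partialDeriv α hα).comp ⟨inclusion h, continuous_inclusion h⟩,
      (γ.partialDeriv_spec α hα).congr_mono (interior_mono h)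
        (fun x hx => by
          rw [zeroExt_apply _ (interior_subset hx), zeroExt_apply _ (h (interior_subset hx))]; rfl)
        (fun x hx => by
          rw [zeroExt_apply _ (interior_subset hx), zeroExt_apply _ (h (interior_subset hx))]
          rfl)⟩⟩
  map_add' _ _ := rfl
  map_smul' _ _ := rfl

end CkMap

/-- The subset `[0,∞[ᵐ × ℝᵈ⁻ᵐ` of `ℝᵈ`: the first `m` coordinates are nonnegative. -/
def orthant (d m : ℕ) : Set (Fin d → ℝ) := {x | ∀ i : Fin d, (i : ℕ) < m → 0 ≤ x i}

end

/-! The proof is Seeley's extension by infinitely many reflections. A function `f` on one side of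
the hyperplane `xᵢ = c` is continued to the other side by `∑ₖ aₖ (χ f)(…, c - 2ᵏ (xᵢ - c), …)`,
where the cutoff `χ` depends on `xᵢ` only and equals 1 near `c`. Differentiating `n` times in `xᵢ`
brings out `(-2ᵏ)ⁿ`, so all derivatives match on the hyperplane once `∑ₖ aₖ (-2ᵏ)ⁿ = 1` for every
`n`; `exists_seeley_sequence` provides such weights. Completeness of `F` plays no role: off the
hyperplane the cutoff leaves finitely many nonzero terms, and on it the series is a scalar series
times a fixed vector (`hasSum_seeleyExt`).

Continuity of the extension operator is turned into joint continuity. An `IsJetOn` family depends on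
a parameter `q ∈ P` as well as on `x`; in the end `P` is `C^ℓ(R, F)` itself. Since `R` is locally
compact, evaluation is continuous and the tautological family is a jet (`CkMap.isJetOn_jet`).
Conversely, a jointly continuous map `P × ℝᵈ → F` induces a continuous map `P → C(ℝᵈ, F)`.

One reflection is `jetsExtend_slab_halfLine`. Differentiability across the hyperplane follows from
continuity of the candidate derivative and differentiability elsewhere
(`hasPartialDerivAt_of_off_hyperplane`), by the mean value theorem and Hahn-Banach. The coordinates
are treated one at a time; the interval `[0, 1]` needs a reflection at each end. -/

noncomputable section

/-! ### Seeley's weights. -/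

section SeeleyCoefficients

/-- The factor `(1 + 2ʲ) / (2ʲ - 2ᵏ)`, for `j ≠ k`, of the Lagrange weights at the point `1` for the
nodes `-2ᵏ`. -/
def seeleyFactor (k j : ℕ) : ℝ := if j = k then 1 else (1 + 2 ^ j) / (2 ^ j - 2 ^ k)

/-- The weights for which `∑ₖ wₖ (-2ᵏ)ⁿ = 1` whenever `n < N`. -/
def seeleyWeight (N k : ℕ) : ℝ := if k < N then ∏ j ∈ Finset.range N, seeleyFactor k j else 0

/-- A bound for `|seeleyWeight N k|` which does not depend on `N`. -/
def seeleyBound (k : ℕ) : ℝ := (∏ j ∈ Finset.range k, 4 * 2 ^ j / 2 ^ k) * Real.exp 4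

theorem seeleyBound_pos (k : ℕ) : 0 < seeleyBound k := by
  unfold seeleyBound; positivity

/-- Passing from `k` to `k + 1` halves each of the `k` old factors and adds the factor `4 * 2 ^ k /
2 ^ (k + 1) = 2`. The ratio tends to 0, so the bound beats every power of `2 ^ k`. -/
theorem seeleyBound_succ (k : ℕ) : seeleyBound (k + 1) = seeleyBound k * (2 * (1 / 2) ^ k) := by
  have h : ∏ j ∈ Finset.range k, (4 * 2 ^ j / 2 ^ (k + 1) : ℝ) =
      (∏ j ∈ Finset.range k, (4 * 2 ^ j / 2 ^ k : ℝ)) * (1 / 2) ^ k := by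
    have hc := Finset.prod_const (s := Finset.range k) (1 / 2 : ℝ)
    rw [Finset.card_range] at hc
    rw [← hc, ← Finset.prod_mul_distrib]
    exact Finset.prod_congr rfl fun j _ => by rw [pow_succ]; field_simp
  rw [seeleyBound, seeleyBound, Finset.prod_range_succ, h, pow_succ (2 : ℝ) k]
  field_simp
  ring

theorem summable_seeleyBound (n : ℕ) : Summable fun k => seeleyBound k * (2 ^ k) ^ n := by
  refine summable_of_ratio_test_tendsto_lt_one (l := 0) one_pos
    (Eventually.of_forall fun k => (mul_pos (seeleyBound_pos k) (by positivity)).ne') ?_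
  have h : Tendsto (fun k : ℕ => (2 * 2 ^ n) * (1 / 2 : ℝ) ^ k) atTop (𝓝 ((2 * 2 ^ n) * 0)) :=
    (tendsto_pow_atTop_nhds_zero_of_lt_one (by norm_num) (by norm_num)).const_mul _
  rw [mul_zero] at h
  refine h.congr fun k => ?_
  have hk := seeleyBound_pos k
  rw [Real.norm_of_nonneg (mul_pos (seeleyBound_pos _) (by positivity)).le,
    Real.norm_of_nonneg (mul_pos (seeleyBound_pos _) (by positivity)).le, seeleyBound_succ,
    pow_succ (2 : ℝ) k, mul_pow]
  field_simp

theorem abs_seeleyFactor_le_of_lt {k j : ℕ} (h : j < k) :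
    |seeleyFactor k j| ≤ 4 * 2 ^ j / 2 ^ k := by
  have h1 : (1 : ℝ) ≤ 2 ^ j := one_le_pow₀ (by norm_num)
  have h2 : (2 : ℝ) * 2 ^ j ≤ 2 ^ k := by
    rw [← pow_succ']; exact pow_le_pow_right₀ (by norm_num) h
  rw [seeleyFactor, if_neg h.ne, abs_div, abs_of_pos (by positivity), abs_of_neg (by linarith),
    div_le_div_iff₀ (by linarith) (by positivity)]
  nlinarith

/-- The factor exceeds 1 by `(1 + 2 ^ k) / (2 ^ j - 2 ^ k) ≤ 4 * 2 ^ k / 2 ^ j`. In exponential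
form, a product over `j` becomes a geometric sum in the exponent. -/
theorem abs_seeleyFactor_le_of_gt {k j : ℕ} (h : k < j) :
    |seeleyFactor k j| ≤ Real.exp (4 * 2 ^ k / 2 ^ j) := by
  have h1 : (1 : ℝ) ≤ 2 ^ k := one_le_pow₀ (by norm_num)
  have h2 : (2 : ℝ) * 2 ^ k ≤ 2 ^ j := by
    rw [← pow_succ']; exact pow_le_pow_right₀ (by norm_num) h
  refine le_trans ?_ (Real.add_one_le_exp _)
  rw [seeleyFactor, if_neg h.ne', abs_div, abs_of_pos (by positivity), abs_of_pos (by linarith),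
    div_add_one (by positivity), div_le_div_iff₀ (by linarith) (by positivity)]
  nlinarith

/-- The factors with `j < k` are bounded by those in `seeleyBound`; for `j > k` the exponents sum to
at most 4. -/
theorem abs_seeleyWeight_le (N k : ℕ) : |seeleyWeight N k| ≤ seeleyBound k := by
  rw [seeleyWeight]
  split_ifs with h
  swap
  · rw [abs_zero]; exact (seeleyBound_pos k).le
  obtain ⟨m, rfl⟩ : ∃ m, N = k + 1 + m := ⟨N - (k + 1), by omega⟩
  rw [Finset.prod_range_add, Finset.prod_range_succ, abs_mul, abs_mul, Finset.abs_prod,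
    Finset.abs_prod, seeleyBound]
  have hk : |seeleyFactor k k| = 1 := by simp [seeleyFactor]
  rw [hk, mul_one]
  refine mul_le_mul (Finset.prod_le_prod (fun _ _ => abs_nonneg _) fun j hj =>
    abs_seeleyFactor_le_of_lt (Finset.mem_range.1 hj)) ?_
    (Finset.prod_nonneg fun _ _ => abs_nonneg _) (Finset.prod_nonneg fun _ _ => by positivity)
  refine (Finset.prod_le_prod (fun _ _ => abs_nonneg _) fun j _ =>
    abs_seeleyFactor_le_of_gt (by omega : k < k + 1 + j)).trans ?_
  rw [← Real.exp_sum, Real.exp_le_exp]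
  have hs : ∀ m : ℕ, ∑ j ∈ Finset.range m, (4 * 2 ^ k / 2 ^ (k + 1 + j) : ℝ) =
      4 * (1 - (1 / 2) ^ m) := by
    intro m
    induction m with
    | zero => simp
    | succ m ih =>
      rw [Finset.sum_range_succ, ih, pow_add, pow_succ, pow_succ, one_div, inv_pow]
      field_simp
      ring
  rw [hs]
  have : (0 : ℝ) ≤ (1 / 2) ^ m := by positivity
  linarith

/-- Lagrange interpolation at `N` nodes reproduces `X ^ n` for `n < N`; the weights are the basis
polynomials evaluated at 1. -/
theorem sum_seeleyWeight {n N : ℕ} (h : n < N) :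
    ∑ k ∈ Finset.range N, seeleyWeight N k * (-2 ^ k) ^ n = 1 := by
  have hinj : Set.InjOn (fun k : ℕ => -(2 : ℝ) ^ k) (Finset.range N : Set ℕ) := by
    intro a _ b _ hab
    exact pow_right_injective₀ (by norm_num : (0 : ℝ) < 2) (by norm_num) (neg_injective hab)
  have hL := Lagrange.eq_interpolate (f := (Polynomial.X : Polynomial ℝ) ^ n) hinj
    (by rw [Polynomial.degree_X_pow, Finset.card_range]; exact_mod_cast h)
  have h1 := congrArg (Polynomial.eval 1) hL
  rw [Lagrange.interpolate_apply, Polynomial.eval_finsetSum, Polynomial.eval_pow,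
    Polynomial.eval_X, one_pow] at h1
  rw [h1]
  refine Finset.sum_congr rfl fun k hk => ?_
  rw [Polynomial.eval_mul, Polynomial.eval_C, Polynomial.eval_pow, Polynomial.eval_X, mul_comm,
    seeleyWeight, if_pos (Finset.mem_range.1 hk), Lagrange.basis, Polynomial.eval_prod,
    ← Finset.prod_erase (Finset.range N) (a := k) (by simp [seeleyFactor])]
  congr 1
  refine Finset.prod_congr rfl fun j hj => ?_
  rw [Lagrange.basisDivisor, seeleyFactor, if_neg (Finset.ne_of_mem_erase hj)]
  simp only [Polynomial.eval_mul, Polynomial.eval_C, Polynomial.eval_sub, Polynomial.eval_X]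
  rw [div_eq_mul_inv, mul_comm]
  congr 2 <;> ring

/-- Seeley's sequence: all moments of the weights `aₖ` at the nodes `-2ᵏ` converge absolutely and
are equal to `1`. -/
theorem exists_seeley_sequence : ∃ a : ℕ → ℝ, ∀ n : ℕ,
    Summable (fun k => |a k * (-2 ^ k) ^ n|) ∧ HasSum (fun k => a k * (-2 ^ k) ^ n) 1 := by
  -- The finite weights lie in a compact product of intervals, so a subsequence converges pointwise;
  -- dominated convergence then carries the moment identities to the limit.
  obtain ⟨a, ha, φ, hφ, hlim⟩ := IsCompact.tendsto_subseq
    (isCompact_univ_pi fun k => isCompact_Icc (a := -seeleyBound k) (b := seeleyBound k))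
    (x := seeleyWeight) fun N k _ => abs_le.1 (abs_seeleyWeight_le N k)
  have habs : ∀ n k : ℕ, |(-2 ^ k : ℝ) ^ n| = (2 ^ k) ^ n := fun n k => by
    rw [abs_pow, abs_neg, abs_of_pos (by positivity)]
  have hsum : ∀ n : ℕ, Summable fun k => |a k * (-2 ^ k) ^ n| := fun n =>
    (summable_seeleyBound n).of_nonneg_of_le (fun _ => abs_nonneg _) fun k => by
      rw [abs_mul, habs]
      exact mul_le_mul_of_nonneg_right (abs_le.2 (ha k (Set.mem_univ k))) (by positivity)
  refine ⟨a, fun n => ⟨hsum n, ?_⟩⟩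
  have ht := tendsto_tsum_of_dominated_convergence (𝓕 := atTop)
    (f := fun N k => seeleyWeight (φ N) k * (-2 ^ k) ^ n) (summable_seeleyBound n)
    (fun k => ((tendsto_pi_nhds.1 hlim k).mul_const _))
    (Eventually.of_forall fun N k => by
      rw [Real.norm_eq_abs, abs_mul, habs]
      exact mul_le_mul_of_nonneg_right (abs_seeleyWeight_le _ k) (by positivity))
  have h1 : ∀ᶠ N in atTop, ∑' k, seeleyWeight (φ N) k * (-2 ^ k) ^ n = 1 := by
    filter_upwards [hφ.tendsto_atTop.eventually_gt_atTop n] with N hN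
    rw [tsum_eq_sum (s := Finset.range (φ N)), sum_seeleyWeight hN]
    intro k hk
    rw [seeleyWeight, if_neg (by simpa using hk), zero_mul]
  have h2 := tendsto_nhds_unique (tendsto_const_nhds.congr' (h1.mono fun _ h => h.symm)) ht
  exact (hsum n).of_abs.hasSum_iff.2 h2.symm

end SeeleyCoefficients

/-! ### Calculus of partial derivatives in locally convex spaces. -/

section PartialDerivatives

variable {d : ℕ} {F : Type*} [AddCommGroup F] [Module ℝ F] [TopologicalSpace F]

theorem continuous_line (x : Fin d → ℝ) (i : Fin d) :
    Continuous fun t : ℝ => x + t • (Pi.single i 1 : Fin d → ℝ) := by fun_prop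

theorem tendsto_line (x : Fin d → ℝ) (i : Fin d) :
    Tendsto (fun t : ℝ => x + t • (Pi.single i 1 : Fin d → ℝ)) (𝓝[≠] 0) (𝓝 x) := by
  have := (continuous_line x i).tendsto 0
  simp only [zero_smul, add_zero] at this
  exact this.mono_left nhdsWithin_le_nhds

theorem line_apply_of_ne (x : Fin d → ℝ) {i p : Fin d} (h : p ≠ i) (t : ℝ) :
    (x + t • (Pi.single p 1 : Fin d → ℝ)) i = x i := by
  simp [Pi.single_eq_of_ne' h]

theorem line_apply_self (x : Fin d → ℝ) (i : Fin d) (t : ℝ) :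
    (x + t • (Pi.single i 1 : Fin d → ℝ)) i = x i + t := by
  simp

theorem hasPartialDerivAt_real_iff {f : (Fin d → ℝ) → ℝ} {i : Fin d} {x : Fin d → ℝ} {v : ℝ} :
    HasPartialDerivAt f i x v ↔ HasDerivAt (fun t : ℝ => f (x + t • Pi.single i 1)) v 0 := by
  rw [hasDerivAt_iff_tendsto_slope_zero, HasPartialDerivAt]
  simp only [zero_add, zero_smul, add_zero]

theorem HasPartialDerivAt.hasDerivAt_line {f : (Fin d → ℝ) → ℝ} {i : Fin d} {x : Fin d → ℝ}
    {t v : ℝ} (h : HasPartialDerivAt f i (x + t • Pi.single i 1) v) :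
    HasDerivAt (fun τ : ℝ => f (x + τ • Pi.single i 1)) v t := by
  rw [hasPartialDerivAt_real_iff] at h
  have h' : HasDerivAt (fun τ : ℝ => f (x + t • Pi.single i 1 + τ • Pi.single i 1)) v (t - t) := by
    rwa [sub_self]
  refine (h'.comp_sub_const t t).congr_of_eventuallyEq (Eventually.of_forall fun τ => ?_)
  simp only [add_assoc, ← add_smul, add_sub_cancel]

theorem HasPartialDerivAt.congr_of_eventuallyEq {f f' : (Fin d → ℝ) → F} {i : Fin d}
    {x : Fin d → ℝ} {v : F} (h : HasPartialDerivAt f i x v) (hf : f' =ᶠ[𝓝 x] f) :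
    HasPartialDerivAt f' i x v := by
  refine Tendsto.congr' ?_ h
  filter_upwards [tendsto_line x i hf] with t ht
  rw [← hf.eq_of_nhds, ← ht]

theorem HasPartialDerivAt.const_comp {f : (Fin d → ℝ) → F} {i : Fin d} {x : Fin d → ℝ} {v : F}
    (L : F →L[ℝ] ℝ) (h : HasPartialDerivAt f i x v) :
    HasPartialDerivAt (fun y => L (f y)) i x (L v) := by
  refine ((L.continuous.tendsto v).comp h).congr fun t => ?_
  simp

theorem hasPartialDerivAt_zero (i : Fin d) (x : Fin d → ℝ) :
    HasPartialDerivAt (fun _ => (0 : F)) i x 0 := by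
  simp [HasPartialDerivAt, tendsto_const_nhds]

theorem HasPartialDerivAt.const_smul [ContinuousSMul ℝ F] {f : (Fin d → ℝ) → F} {i : Fin d}
    {x : Fin d → ℝ} {v : F} (h : HasPartialDerivAt f i x v) (c : ℝ) :
    HasPartialDerivAt (fun y => c • f y) i x (c • v) := by
  refine (Tendsto.const_smul h c).congr fun t => ?_
  rw [smul_comm, smul_sub]

theorem HasPartialDerivAt.sum [IsTopologicalAddGroup F] {ι : Type*} {s : Finset ι}
    {f : ι → (Fin d → ℝ) → F} {i : Fin d} {x : Fin d → ℝ} {v : ι → F}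
    (h : ∀ k ∈ s, HasPartialDerivAt (f k) i x (v k)) :
    HasPartialDerivAt (fun y => ∑ k ∈ s, f k y) i x (∑ k ∈ s, v k) := by
  refine (tendsto_finsetSum s h).congr fun t => ?_
  rw [← Finset.smul_sum, Finset.sum_sub_distrib]

theorem HasPartialDerivAt.smul [IsTopologicalAddGroup F] [ContinuousSMul ℝ F]
    {c : (Fin d → ℝ) → ℝ} {f : (Fin d → ℝ) → F} {i : Fin d} {x : Fin d → ℝ} {c' : ℝ} {v : F}
    (hc : HasPartialDerivAt c i x c') (h : HasPartialDerivAt f i x v) :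
    HasPartialDerivAt (fun y => c y • f y) i x (c x • v + c' • f x) := by
  have hcont : Tendsto (fun t : ℝ => c (x + t • Pi.single i 1)) (𝓝[≠] 0) (𝓝 (c x)) := by
    have := (hasPartialDerivAt_real_iff.1 hc).continuousAt.tendsto
    simp only [zero_smul, add_zero] at this
    exact this.mono_left nhdsWithin_le_nhds
  refine ((hcont.smul h).add (Tendsto.smul_const hc (f x))).congr fun t => ?_
  simp only [smul_sub, sub_smul, smul_assoc, smul_comm (c _) t⁻¹]
  abel

theorem HasPartialDerivAt.comp_affine [ContinuousSMul ℝ F] {f : (Fin d → ℝ) → F} {i : Fin d}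
    {x : Fin d → ℝ} {v : F} {y : (Fin d → ℝ) → (Fin d → ℝ)} {β : ℝ} (hβ : β ≠ 0)
    (hy : ∀ t : ℝ, y (x + t • Pi.single i 1) = y x + (β * t) • Pi.single i 1)
    (h : HasPartialDerivAt f i (y x) v) : HasPartialDerivAt (fun z => f (y z)) i x (β • v) := by
  have ht : Tendsto (fun t : ℝ => β * t) (𝓝[≠] 0) (𝓝[≠] 0) := by
    refine tendsto_nhdsWithin_of_tendsto_nhds_of_eventually_within _ ?_ ?_
    · have : Continuous fun t : ℝ => β * t := by fun_prop
      have := this.tendsto 0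
      rw [mul_zero] at this
      exact this.mono_left nhdsWithin_le_nhds
    · filter_upwards [self_mem_nhdsWithin] with t h0
      exact mul_ne_zero hβ h0
  refine ((h.comp ht).const_smul β).congr fun t => ?_
  simp only [Function.comp_apply, smul_smul, hy]
  congr 1
  rw [mul_inv]
  field_simp

/-- A partial derivative of a function with values in a locally convex space can be recognized by
means of continuous linear functionals, if the candidate for the derivative is continuous. -/
theorem hasPartialDerivAt_of_forall_dual [IsTopologicalAddGroup F] [ContinuousSMul ℝ F]
    [LocallyConvexSpace ℝ F] {U : Set (Fin d → ℝ)} (hU : IsOpen U) {f g : (Fin d → ℝ) → F}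
    {i : Fin d} (hg : ContinuousOn g U)
    (h : ∀ L : F →L[ℝ] ℝ, ∀ x ∈ U, HasPartialDerivAt (fun y => L (f y)) i x (L (g x))) :
    ∀ x ∈ U, HasPartialDerivAt f i x (g x) := by
  intro x hx
  have hp := with_gaugeSeminormFamily (𝕜 := ℝ) (E := F)
  refine (hp.tendsto_nhds _ _).2 fun j ε hε => ?_
  set p := gaugeSeminormFamily ℝ F j
  have hpc : Continuous p := hp.continuous_seminorm j
  -- It suffices that the difference quotients lie in this closed convex set. Otherwise a functional
  -- `L` separates one of them from `C`, while the mean value theorem for `L ∘ f` gives it the same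
  -- `L`-value as some `g y ∈ C`.
  set C : Set F := {z | p (z - g x) ≤ ε / 2}
  have hCcl : IsClosed C := isClosed_le (hpc.comp (continuous_id.sub continuous_const))
    continuous_const
  have hCco : Convex ℝ C := by
    have : C = p.closedBall (g x) (ε / 2) := by ext z; simp [C, Seminorm.mem_closedBall]
    rw [this]
    exact p.convex_closedBall _ _
  have hgC : ∀ᶠ y in 𝓝 x, y ∈ U ∧ g y ∈ C := by
    have h1 := (hg.continuousAt (hU.mem_nhds hx))
    have h2 := ((hp.tendsto_nhds _ _).1 h1.tendsto) j (ε / 2) (by positivity)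
    filter_upwards [h2, hU.mem_nhds hx] with y hy hyU using ⟨hyU, hy.le⟩
  obtain ⟨δ, hδ, hball⟩ := Metric.eventually_nhds_iff.1
    (((continuous_line x i).tendsto' 0 x (by simp)).eventually hgC)
  have hlt : ∀ᶠ t : ℝ in 𝓝[≠] 0, |t| < δ := by
    filter_upwards [mem_nhdsWithin_of_mem_nhds (Metric.ball_mem_nhds (0 : ℝ) hδ)] with t ht
    simpa using ht
  filter_upwards [hlt, self_mem_nhdsWithin] with t ht ht0
  suffices hz : t⁻¹ • (f (x + t • Pi.single i 1) - f x) ∈ C from lt_of_le_of_lt hz (by linarith)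
  by_contra hz
  obtain ⟨L, u, hLu, huL⟩ := geometric_hahn_banach_closed_point hCco hCcl hz
  have hsmall : ∀ τ ∈ Icc (0 : ℝ) 1, dist (τ * t) 0 < δ := fun τ hτ => by
    rw [dist_zero_right, Real.norm_eq_abs, abs_mul, abs_of_nonneg hτ.1]
    exact (mul_le_of_le_one_left (abs_nonneg t) hτ.2).trans_lt ht
  have hder : ∀ τ ∈ Icc (0 : ℝ) 1,
      HasDerivAt (fun τ : ℝ => L (f (x + (τ * t) • Pi.single i 1)))
        (L (g (x + (τ * t) • Pi.single i 1)) * t) τ := by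
    intro τ hτ
    have h1 := (h L _ (hball (hsmall τ hτ)).1).hasDerivAt_line
    exact h1.comp τ (hasDerivAt_mul_const t)
  obtain ⟨τ, hτ, hslope⟩ := exists_hasDerivAt_eq_slope
    (fun τ : ℝ => L (f (x + (τ * t) • Pi.single i 1)))
    (fun τ : ℝ => L (g (x + (τ * t) • Pi.single i 1)) * t) one_pos
    (fun τ hτ => (hder τ hτ).continuousAt.continuousWithinAt)
    (fun τ hτ => hder τ (Ioo_subset_Icc_self hτ))
  have h2 := hLu _ (hball (hsmall τ (Ioo_subset_Icc_self hτ))).2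
  simp only [one_mul, zero_mul, zero_smul, add_zero, sub_zero, div_one] at hslope
  rw [map_smul, map_sub, ← hslope, smul_eq_mul, mul_comm, mul_assoc,
    mul_inv_cancel₀ ht0, mul_one] at huL
  exact lt_asymm h2 huL

/-- The mean value theorem needs the derivative only in the interior of a segment and continuity at
its ends. A segment from `x` in direction `i` meets the hyperplane only at `x`; one in another
direction lies inside it and is a limit of parallel segments that avoid it. -/
theorem hasPartialDerivAt_real_of_off_hyperplane {U : Set (Fin d → ℝ)} (hU : IsOpen U)
    {f g : (Fin d → ℝ) → ℝ} {i p : Fin d} {c : ℝ} (hf : ContinuousOn f U) (hg : ContinuousOn g U)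
    (h : ∀ x ∈ U, x i ≠ c → HasPartialDerivAt f p x (g x)) :
    ∀ x ∈ U, HasPartialDerivAt f p x (g x) := by
  intro x hx
  by_cases hxc : x i = c
  swap
  · exact h x hx hxc
  refine (Metric.tendsto_nhds).2 fun ε hε => ?_
  have hgx : ∀ᶠ y in 𝓝 x, y ∈ U ∧ |g y - g x| ≤ ε / 2 := by
    filter_upwards [Metric.tendsto_nhds.1 (hg.continuousAt (hU.mem_nhds hx)).tendsto (ε / 2)
      (by positivity), hU.mem_nhds hx] with y hy hyU using ⟨hyU, by rw [← Real.dist_eq]; exact hy.le⟩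
  obtain ⟨δ, hδ, hball⟩ := Metric.eventually_nhds_iff_ball.1 hgx
  -- the mean value estimate on segments in the ball whose interior avoids the hyperplane
  have key : ∀ y : Fin d → ℝ, ∀ t : ℝ, y ∈ Metric.ball x δ → y + t • Pi.single p 1 ∈ Metric.ball x δ →
      (∀ τ ∈ Ioo (0 : ℝ) 1, (y + (τ * t) • Pi.single p 1 : Fin d → ℝ) i ≠ c) →
      |f (y + t • Pi.single p 1) - f y - t * g x| ≤ ε / 2 * |t| := by
    intro y t hy hyt hne
    have hseg : ∀ τ ∈ Icc (0 : ℝ) 1,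
        (y + (τ * t) • Pi.single p 1 : Fin d → ℝ) ∈ Metric.ball x δ := by
      intro τ hτ
      have := (convex_ball x δ).add_smul_mem hy hyt hτ
      rwa [smul_smul] at this
    have hc : Continuous fun τ : ℝ => (y + (τ * t) • Pi.single p 1 : Fin d → ℝ) := by fun_prop
    obtain ⟨τ, hτ, hslope⟩ := exists_hasDerivAt_eq_slope
      (fun τ : ℝ => f (y + (τ * t) • Pi.single p 1))
      (fun τ : ℝ => g (y + (τ * t) • Pi.single p 1) * t) one_pos
      (hf.comp hc.continuousOn fun τ hτ => (hball _ (hseg τ hτ)).1)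
      (fun τ hτ => by
        have h1 := (h _ (hball _ (hseg τ (Ioo_subset_Icc_self hτ))).1 (hne τ hτ)).hasDerivAt_line
        exact h1.comp τ (hasDerivAt_mul_const t))
    simp only [one_mul, zero_mul, zero_smul, add_zero, sub_zero, div_one] at hslope
    rw [← hslope, mul_comm t, ← sub_mul, abs_mul]
    exact mul_le_mul_of_nonneg_right (hball _ (hseg τ (Ioo_subset_Icc_self hτ))).2 (abs_nonneg t)
  have key' : ∀ t : ℝ, t ≠ 0 → x + t • Pi.single p 1 ∈ Metric.ball x δ →
      |f (x + t • Pi.single p 1) - f x - t * g x| ≤ ε / 2 * |t| := by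
    intro t ht0 ht
    by_cases hpi : p = i
    · subst hpi
      refine key x t (Metric.mem_ball_self hδ) ht fun τ hτ => ?_
      rw [line_apply_self, hxc]
      simp [hτ.1.ne', ht0]
    -- Shift the segment by `η` in direction `i`, apply the estimate there and let `η → 0`.
    · have hη := tendsto_line x i
      have hη' : Tendsto (fun η : ℝ => x + η • (Pi.single i 1 : Fin d → ℝ) +
          t • (Pi.single p 1 : Fin d → ℝ)) (𝓝[≠] 0) (𝓝 (x + t • Pi.single p 1)) :=
        hη.add_const _
      have hfx := ((hf.continuousAt (hU.mem_nhds hx)).tendsto.comp hη)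
      have hfx' := ((hf.continuousAt (hU.mem_nhds (hball _ ht).1)).tendsto.comp hη')
      refine le_of_tendsto ((hfx'.sub hfx).sub_const (t * g x)).abs ?_
      filter_upwards [hη (Metric.isOpen_ball.mem_nhds (Metric.mem_ball_self hδ)),
        hη' (Metric.isOpen_ball.mem_nhds ht), self_mem_nhdsWithin] with η h1 h2 h3
      refine key _ t h1 h2 fun τ _ => ?_
      rw [line_apply_of_ne _ hpi, line_apply_self, hxc]
      simpa using h3
  filter_upwards [tendsto_line x p (Metric.isOpen_ball.mem_nhds (Metric.mem_ball_self hδ)),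
    self_mem_nhdsWithin] with t ht ht0
  have ht0 : t ≠ 0 := ht0
  have h1 := key' t ht0 ht
  have h2 : t⁻¹ • (f (x + t • Pi.single p 1) - f x) - g x =
      t⁻¹ * (f (x + t • Pi.single p 1) - f x - t * g x) := by
    rw [smul_eq_mul]; field_simp
  rw [Real.dist_eq, h2, abs_mul, abs_inv]
  have h3 : 0 < |t| := abs_pos.2 ht0
  calc |t|⁻¹ * |f (x + t • Pi.single p 1) - f x - t * g x| ≤ |t|⁻¹ * (ε / 2 * |t|) := by gcongr
    _ = ε / 2 := by field_simp
    _ < ε := by linarith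

/-- If `f` and `g` are continuous on an open set and `∂ₚ f = g` outside a hyperplane `xᵢ = c`, then
`∂ₚ f = g` on the whole open set. -/
theorem hasPartialDerivAt_of_off_hyperplane [IsTopologicalAddGroup F] [ContinuousSMul ℝ F]
    [LocallyConvexSpace ℝ F] {U : Set (Fin d → ℝ)} (hU : IsOpen U) {f g : (Fin d → ℝ) → F}
    {i p : Fin d} {c : ℝ} (hf : ContinuousOn f U) (hg : ContinuousOn g U)
    (h : ∀ x ∈ U, x i ≠ c → HasPartialDerivAt f p x (g x)) :
    ∀ x ∈ U, HasPartialDerivAt f p x (g x) :=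
  hasPartialDerivAt_of_forall_dual hU hg fun L =>
    hasPartialDerivAt_real_of_off_hyperplane hU (L.continuous.comp_continuousOn hf)
      (L.continuous.comp_continuousOn hg) fun x hx hxc => (h x hx hxc).const_comp L

end PartialDerivatives

/-! ### Product sets with a distinguished coordinate. -/

/-- A product of subsets of `ℝ`, with `J` as the `i`-th factor and the sets `B j` as the others. -/
def slab {d : ℕ} (B : Fin d → Set ℝ) (i : Fin d) (J : Set ℝ) : Set (Fin d → ℝ) :=
  Set.pi univ (Function.update B i J)

section Slab

variable {d : ℕ} {B : Fin d → Set ℝ} {i : Fin d} {J : Set ℝ} {x : Fin d → ℝ}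

theorem mem_slab : x ∈ slab B i J ↔ x i ∈ J ∧ ∀ j, j ≠ i → x j ∈ B j := by
  simp only [slab, mem_univ_pi]
  refine ⟨fun h => ⟨by simpa using h i, fun j hj => by simpa [hj] using h j⟩, fun h j => ?_⟩
  rcases eq_or_ne j i with rfl | hj
  · simpa using h.1
  · simpa [hj] using h.2 j hj

theorem interior_slab : interior (slab B i J) = slab (fun j => interior (B j)) i (interior J) := by
  rw [slab, slab, interior_pi_set finite_univ]
  congr 1
  ext1 j
  rcases eq_or_ne j i with rfl | hj
  · simp
  · simp [hj]

theorem update_mem_slab {J' : Set ℝ} (hx : x ∈ slab B i J) {t : ℝ} (ht : t ∈ J') :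
    Function.update x i t ∈ slab B i J' := by
  rw [mem_slab] at hx ⊢
  exact ⟨by simpa using ht, fun j hj => by simpa [hj] using hx.2 j hj⟩

end Slab

/-! ### Jets and cutoff functions. -/

theorem hasDerivAt_iteratedDeriv {χ : ℝ → ℝ} (hχ : ContDiff ℝ (⊤ : ℕ∞) χ) (n : ℕ) (t : ℝ) :
    HasDerivAt (iteratedDeriv n χ) (iteratedDeriv (n + 1) χ t) t := by
  rw [iteratedDeriv_succ]
  exact ((hχ.differentiable_iteratedDeriv n (by exact_mod_cast ENat.natCast_lt_top n)) t).hasDerivAt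

/-- At `c` the cutoff has the jet of the constant 1, so multiplication by it does not alter a jet on
the hyperplane. Vanishing beyond distance 1/2 lets the product extend by zero from a collar of width
1. -/
theorem exists_smooth_cutoff (c : ℝ) : ∃ χ : ℝ → ℝ, ContDiff ℝ (⊤ : ℕ∞) χ ∧
    (∀ n, iteratedDeriv n χ c = if n = 0 then 1 else 0) ∧
    ∀ n t, 1 / 2 < |t - c| → iteratedDeriv n χ t = 0 := by
  let φ : ContDiffBump c := ⟨1 / 4, 1 / 2, by norm_num, by norm_num⟩
  refine ⟨φ, φ.contDiff, fun n => ?_, fun n t ht => ?_⟩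
  · rw [φ.eventuallyEq_one.iteratedDeriv_eq n]
    rcases n with _ | n
    · simp
    · exact iteratedDeriv_const (𝕜 := ℝ) (n := n + 1) (c := (1 : ℝ)) (x := c)
  · have hz : (φ : ℝ → ℝ) =ᶠ[𝓝 t] fun _ => 0 := by
      have ho : IsOpen {t : ℝ | 1 / 2 < |t - c|} := isOpen_lt (by fun_prop) (by fun_prop)
      filter_upwards [ho.mem_nhds ht] with u hu
      exact φ.zero_of_le_dist (le_of_lt hu)
    rw [hz.iteratedDeriv_eq n]
    simp

/-- A family of `C^ℓ`-functions on `R`, depending linearly on `q` and given together with its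
partial derivatives `f α q = ∂^α (f 0 q)`, such that the latter are jointly continuous. -/
structure IsJetOn {d : ℕ} {P F : Type*} [AddCommGroup P] [Module ℝ P] [TopologicalSpace P]
    [AddCommGroup F] [Module ℝ F] [TopologicalSpace F] (ℓ : ℕ∞) (R : Set (Fin d → ℝ))
    (f : (Fin d → ℕ) → P → (Fin d → ℝ) → F) : Prop where
  isLinearMap : ∀ α : Fin d → ℕ, ((∑ j, α j : ℕ) : ℕ∞) ≤ ℓ → ∀ x ∈ R,
    IsLinearMap ℝ fun q => f α q x
  continuousOn : ∀ α : Fin d → ℕ, ((∑ j, α j : ℕ) : ℕ∞) ≤ ℓ →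
    ContinuousOn (fun z : P × (Fin d → ℝ) => f α z.1 z.2) (univ ×ˢ R)
  -- Only the case where `p` precedes every index occurring in `α` is required. This is the order of
  -- differentiation in `multiIndexWord`, so symmetry of mixed derivatives is never used.
  hasPartialDerivAt : ∀ (α : Fin d → ℕ) (p : Fin d), (∀ j < p, α j = 0) →
    ((∑ j, (α + Pi.single p 1 : Fin d → ℕ) j : ℕ) : ℕ∞) ≤ ℓ → ∀ q, ∀ x ∈ interior R,
      HasPartialDerivAt (f α q) p x (f (α + Pi.single p 1) q x)

theorem degree_le_of_le {d : ℕ} {ℓ : ℕ∞} {α β : Fin d → ℕ} (h : α ≤ β)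
    (hβ : ((∑ j, β j : ℕ) : ℕ∞) ≤ ℓ) : ((∑ j, α j : ℕ) : ℕ∞) ≤ ℓ :=
  le_trans (by exact_mod_cast Finset.sum_le_sum fun j _ => h j) hβ

section Leibniz

variable {d : ℕ} {P F : Type*} [AddCommGroup F] [Module ℝ F]

/-- The partial derivatives of `x ↦ χ(xᵢ) f(x)`, by the Leibniz rule. -/
def cutoffJet (χ : ℝ → ℝ) (i : Fin d) (f : (Fin d → ℕ) → P → (Fin d → ℝ) → F) :
    (Fin d → ℕ) → P → (Fin d → ℝ) → F := fun α q x =>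
  ∑ jk ∈ Finset.HasAntidiagonal.antidiagonal (α i),
    (α i).choose jk.1 • (iteratedDeriv jk.1 χ (x i) • f (Function.update α i jk.2) q x)

variable {χ : ℝ → ℝ} {i : Fin d} {f : (Fin d → ℕ) → P → (Fin d → ℝ) → F}

theorem cutoffJet_eq_zero {α : Fin d → ℕ} {q : P} {x : Fin d → ℝ}
    (h : ∀ n, iteratedDeriv n χ (x i) = 0) : cutoffJet χ i f α q x = 0 :=
  Finset.sum_eq_zero fun jk _ => by rw [h, zero_smul, smul_zero]

theorem cutoffJet_eq_self {α : Fin d → ℕ} {q : P} {x : Fin d → ℝ}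
    (h : ∀ n, iteratedDeriv n χ (x i) = if n = 0 then 1 else 0) :
    cutoffJet χ i f α q x = f α q x := by
  rw [cutoffJet, Finset.sum_eq_single (0, α i)]
  · simp [h]
  · rintro ⟨j, k⟩ hjk hne
    have : j ≠ 0 := by
      rintro rfl
      exact hne (by simpa using hjk)
    simp [h, this]
  · simp

theorem update_le_of_mem_antidiagonal {α : Fin d → ℕ} {jk : ℕ × ℕ}
    (h : jk ∈ Finset.HasAntidiagonal.antidiagonal (α i)) : Function.update α i jk.2 ≤ α := by
  rw [update_le_iff]
  exact ⟨by have := Finset.HasAntidiagonal.mem_antidiagonal.1 h; omega, fun _ _ => le_rfl⟩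

end Leibniz

section Cutoff

variable {d : ℕ} {P F : Type*} [AddCommGroup P] [Module ℝ P] [TopologicalSpace P]
  [AddCommGroup F] [Module ℝ F] [TopologicalSpace F]
  {χ : ℝ → ℝ} {i : Fin d} {f : (Fin d → ℕ) → P → (Fin d → ℝ) → F}

theorem IsJetOn.isLinearMap_cutoffJet {ℓ : ℕ∞} {R : Set (Fin d → ℝ)} (hf : IsJetOn ℓ R f)
    {α : Fin d → ℕ} (hα : ((∑ j, α j : ℕ) : ℕ∞) ≤ ℓ) {x : Fin d → ℝ} (hx : x ∈ R) :
    IsLinearMap ℝ fun q => cutoffJet χ i f α q x := by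
  have hl : ∀ jk ∈ Finset.HasAntidiagonal.antidiagonal (α i),
      IsLinearMap ℝ fun q => f (Function.update α i jk.2) q x := fun jk hjk =>
    hf.isLinearMap _ (degree_le_of_le (update_le_of_mem_antidiagonal hjk) hα) x hx
  constructor
  · intro q r
    simp only [cutoffJet]
    rw [← Finset.sum_add_distrib]
    exact Finset.sum_congr rfl fun jk hjk => by rw [(hl jk hjk).map_add, smul_add, smul_add]
  · intro r q
    simp only [cutoffJet]
    rw [Finset.smul_sum]
    exact Finset.sum_congr rfl fun jk hjk => by
      rw [(hl jk hjk).map_smul, smul_comm r, smul_comm r]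

theorem IsJetOn.continuousOn_cutoffJet [IsTopologicalAddGroup F] [ContinuousSMul ℝ F] {ℓ : ℕ∞}
    {R : Set (Fin d → ℝ)} (hf : IsJetOn ℓ R f) (hχ : ContDiff ℝ (⊤ : ℕ∞) χ)
    {α : Fin d → ℕ} (hα : ((∑ j, α j : ℕ) : ℕ∞) ≤ ℓ) :
    ContinuousOn (fun z : P × (Fin d → ℝ) => cutoffJet χ i f α z.1 z.2) (univ ×ˢ R) := by
  refine continuousOn_finsetSum _ fun jk hjk => ContinuousOn.fun_const_smul (ContinuousOn.smul ?_
    (hf.continuousOn _ (degree_le_of_le (update_le_of_mem_antidiagonal hjk) hα))) _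
  have h1 : Continuous (iteratedDeriv jk.1 χ) :=
    continuous_iff_continuousAt.2 fun t => (hasDerivAt_iteratedDeriv hχ jk.1 t).continuousAt
  exact (h1.comp ((continuous_apply i).comp continuous_snd)).continuousOn

theorem hasPartialDerivAt_comp_apply {u : ℝ → ℝ} {u' : ℝ} {p : Fin d} {x : Fin d → ℝ}
    (h : HasDerivAt u u' (x i)) :
    HasPartialDerivAt (fun y => u (y i)) p x (if p = i then u' else 0) := by
  rw [hasPartialDerivAt_real_iff]
  split_ifs with hp
  · subst hp
    simp only [line_apply_self]
    have h0 : HasDerivAt u u' (x p + 0) := by rwa [add_zero]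
    simpa using h0.comp_const_add (x p) 0
  · simp only [line_apply_of_ne _ hp]
    exact hasDerivAt_const _ _

/-- For `p = i`, the product rule applied to each summand and Pascal's rule give the next Leibniz
sum. For `p ≠ i`, the factor `χ(xᵢ)` is constant in direction `p`. -/
theorem IsJetOn.hasPartialDerivAt_cutoffJet [IsTopologicalAddGroup F] [ContinuousSMul ℝ F]
    {ℓ : ℕ∞} {R : Set (Fin d → ℝ)} (hf : IsJetOn ℓ R f) (hχ : ContDiff ℝ (⊤ : ℕ∞) χ)
    {α : Fin d → ℕ} {p : Fin d} (hp : ∀ j < p, α j = 0)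
    (hα : ((∑ j, (α + Pi.single p 1 : Fin d → ℕ) j : ℕ) : ℕ∞) ≤ ℓ) (q : P) {x : Fin d → ℝ}
    (hx : x ∈ interior R) :
    HasPartialDerivAt (cutoffJet χ i f α q) p x (cutoffJet χ i f (α + Pi.single p 1) q x) := by
  have hle : ∀ jk ∈ Finset.HasAntidiagonal.antidiagonal (α i),
      Function.update α i jk.2 + Pi.single p 1 ≤ α + Pi.single p 1 := fun jk hjk =>
    add_le_add_left (update_le_of_mem_antidiagonal hjk) _
  have hz : ∀ jk ∈ Finset.HasAntidiagonal.antidiagonal (α i), ∀ j < p, Function.update α i jk.2 j = 0 :=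
    fun jk hjk j hj => Nat.le_zero.1
      ((update_le_of_mem_antidiagonal hjk j).trans (hp j hj).le)
  have key := HasPartialDerivAt.sum (s := Finset.HasAntidiagonal.antidiagonal (α i)) fun jk hjk =>
    (((hasPartialDerivAt_comp_apply (p := p) (hasDerivAt_iteratedDeriv hχ jk.1 (x i))).smul
      (hf.hasPartialDerivAt _ p (hz jk hjk) (degree_le_of_le (hle jk hjk) hα) q x hx)).const_smul
        ((α i).choose jk.1 : ℝ))
  simp only [Nat.cast_smul_eq_nsmul] at key
  refine Eq.mp (congrArg _ (Eq.symm ?_)) key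
  simp only [cutoffJet]
  by_cases hpi : p = i
  · subst hpi
    have h1 : ∀ k, Function.update (α + Pi.single p 1) p k = Function.update α p k := by
      intro k
      ext j
      rcases eq_or_ne j p with rfl | hj
      · simp
      · simp [hj]
    have h2 : ∀ k, Function.update α p k + Pi.single p 1 = Function.update α p (k + 1) := by
      intro k
      ext j
      rcases eq_or_ne j p with rfl | hj
      · simp
      · simp [hj]
    simp only [h1, h2, Pi.add_apply, Pi.single_eq_same, if_true, smul_add]
    rw [Finset.sum_antidiagonal_choose_succ_nsmul
      (fun j k => iteratedDeriv j χ (x p) • f (Function.update α p k) q x), Finset.sum_add_distrib]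
    congr 1
    refine Finset.sum_congr rfl fun jk hjk => ?_
    rw [Nat.choose_symm_of_eq_add (Finset.HasAntidiagonal.mem_antidiagonal.1 hjk).symm]
  · have h1 : ∀ k, Function.update (α + Pi.single p 1) i k =
        Function.update α i k + Pi.single p 1 := by
      intro k
      ext j
      rcases eq_or_ne j i with rfl | hj
      · simp [Pi.single_eq_of_ne' hpi]
      · simp [hj]
    simp [h1, hpi]

/-- Multiplication by a cutoff function makes a jet extend by zero. -/
theorem IsJetOn.cutoffJet [IsTopologicalAddGroup F] [ContinuousSMul ℝ F] {ℓ : ℕ∞}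
    {B : Fin d → Set ℝ} {J : Set ℝ} {σ c : ℝ} (hJ : ∀ t, 0 ≤ σ * (t - c) → σ * (t - c) < 1 → t ∈ J)
    (hχ : ContDiff ℝ (⊤ : ℕ∞) χ)
    (hχ0 : ∀ n t, 1 / 2 < σ * (t - c) → iteratedDeriv n χ t = 0)
    (hf : IsJetOn ℓ (slab B i (J ∩ {t | 0 ≤ σ * (t - c)})) f) :
    IsJetOn ℓ (slab B i {t | 0 ≤ σ * (t - c)}) (cutoffJet χ i f) := by
  have hmem : ∀ x ∈ slab B i {t | 0 ≤ σ * (t - c)}, σ * (x i - c) < 1 →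
      x ∈ slab B i (J ∩ {t | 0 ≤ σ * (t - c)}) := fun x hx h1 =>
    mem_slab.2 ⟨⟨hJ _ (mem_slab.1 hx).1 h1, (mem_slab.1 hx).1⟩, (mem_slab.1 hx).2⟩
  have ho1 : IsOpen {x : Fin d → ℝ | σ * (x i - c) < 1} :=
    isOpen_lt (by fun_prop) continuous_const
  have ho2 : IsOpen {x : Fin d → ℝ | 1 / 2 < σ * (x i - c)} :=
    isOpen_lt continuous_const (by fun_prop)
  -- Each point lies in one of two overlapping open regions: for `σ (xᵢ - c) < 1` the jet `f` is
  -- available, and for `σ (xᵢ - c) > 1/2` the product vanishes, whatever values `f` has there.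
  refine ⟨fun α hα x hx => ?_, fun α hα z hz => ?_, fun α p hp hα q x hx => ?_⟩
  · rcases lt_or_ge (σ * (x i - c)) 1 with h1 | h1
    · exact hf.isLinearMap_cutoffJet hα (hmem x hx h1)
    · have h0 : ∀ q, _root_.cutoffJet χ i f α q x = 0 := fun q =>
        cutoffJet_eq_zero fun n => hχ0 n _ (by linarith)
      exact ⟨fun q r => by simp [h0], fun r q => by simp [h0]⟩
  · rcases lt_or_ge (σ * (z.2 i - c)) 1 with h1 | h1
    · refine (hf.continuousOn_cutoffJet hχ hα z ⟨mem_univ _, hmem _ hz.2 h1⟩).mono_of_mem_nhdsWithin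
        ?_
      filter_upwards [self_mem_nhdsWithin,
        mem_nhdsWithin_of_mem_nhds ((ho1.preimage continuous_snd).mem_nhds h1)] with y hy hy1
      exact ⟨mem_univ _, hmem _ hy.2 hy1⟩
    · refine ContinuousAt.continuousWithinAt ?_
      refine (continuousAt_const (y := (0 : F))).congr ?_
      have h2 : z ∈ Prod.snd ⁻¹' {x : Fin d → ℝ | 1 / 2 < σ * (x i - c)} := by
        change 1 / 2 < σ * (z.2 i - c); linarith
      filter_upwards [(ho2.preimage continuous_snd).mem_nhds h2] with y hy
      exact (cutoffJet_eq_zero fun n => hχ0 n _ hy).symm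
  · rcases lt_or_ge (σ * (x i - c)) 1 with h1 | h1
    · refine hf.hasPartialDerivAt_cutoffJet hχ hp hα q ?_
      refine interior_maximal (fun y hy => hmem y (interior_subset hy.1) hy.2)
        (isOpen_interior.inter ho1) ⟨hx, h1⟩
    · have h2 : 1 / 2 < σ * (x i - c) := by linarith
      rw [cutoffJet_eq_zero fun n => hχ0 n _ h2]
      refine (hasPartialDerivAt_zero p x).congr_of_eventuallyEq ?_
      filter_upwards [ho2.mem_nhds h2] with y hy
      exact cutoffJet_eq_zero fun n => hχ0 n _ hy

end Cutoff

/-! ### The Seeley series. -/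

/-- The map `x ↦ (x₁, …, xᵢ₋₁, c - 2ᵏ (xᵢ - c), xᵢ₊₁, …)`. -/
def seeleyReflect {d : ℕ} (i : Fin d) (c : ℝ) (k : ℕ) (x : Fin d → ℝ) : Fin d → ℝ :=
  Function.update x i (c + -2 ^ k * (x i - c))

/-- Seeley's extension of a jet `h` across the hyperplane `xᵢ = c`. -/
def seeleyExt {d : ℕ} {P F : Type*} [AddCommGroup F] [Module ℝ F] [TopologicalSpace F] (a : ℕ → ℝ)
    (i : Fin d) (c : ℝ) (h : (Fin d → ℕ) → P → (Fin d → ℝ) → F) :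
    (Fin d → ℕ) → P → (Fin d → ℝ) → F := fun α q x =>
  ∑' k, (a k * (-2 ^ k) ^ α i) • h α q (seeleyReflect i c k x)

theorem Seminorm.le_tsum_of_hasSum {ι F : Type*} [AddCommGroup F] [Module ℝ F]
    [TopologicalSpace F] (p : Seminorm ℝ F) (hp : Continuous p) {f : ι → F} {v : F}
    (hf : HasSum f v) (hs : Summable fun k => p (f k)) : p v ≤ ∑' k, p (f k) :=
  le_of_tendsto_of_tendsto' ((hp.tendsto v).comp hf) hs.hasSum fun s =>
    Finset.le_sum_of_subadditive p (map_zero p).le (map_add_le_add p) s f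

theorem exists_forall_one_le_two_pow_mul {δ : ℝ} (hδ : 0 < δ) :
    ∃ N : ℕ, ∀ k, N ≤ k → 1 ≤ 2 ^ k * δ := by
  obtain ⟨N, hN⟩ := eventually_atTop.1
    ((tendsto_pow_atTop_atTop_of_one_lt (one_lt_two (α := ℝ))).eventually_ge_atTop (1 / δ))
  exact ⟨N, fun k hk => (div_le_iff₀ hδ).1 (hN k hk)⟩

section SeeleyReflection

variable {d : ℕ} {P F : Type*} [AddCommGroup F] [Module ℝ F] [TopologicalSpace F]
  {a : ℕ → ℝ} {i : Fin d} {σ c : ℝ}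
  {h : (Fin d → ℕ) → P → (Fin d → ℝ) → F}

/-- With `σ = ±1`, `σ (xᵢ - c)` is a signed distance to the hyperplane; reflection multiplies it by
`-2 ^ k`, so for `x` off the hyperplane the reflected points leave the support of the cutoff as `k`
grows. -/
theorem seeleyReflect_apply_sub (k : ℕ) (x : Fin d → ℝ) :
    σ * (seeleyReflect i c k x i - c) = 2 ^ k * -(σ * (x i - c)) := by
  simp only [seeleyReflect, Function.update_self]; ring

theorem seeleyReflect_of_eq {x : Fin d → ℝ} (hx : x i = c) (k : ℕ) :
    seeleyReflect i c k x = x := by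
  rw [seeleyReflect, hx, sub_self, mul_zero, add_zero, ← hx, Function.update_eq_self]

theorem seeleyReflect_mem_slab {B : Fin d → Set ℝ} {x : Fin d → ℝ}
    (hx : x ∈ slab B i {t | σ * (t - c) ≤ 0}) (k : ℕ) :
    seeleyReflect i c k x ∈ slab B i {t | 0 ≤ σ * (t - c)} := by
  refine update_mem_slab hx ?_
  have h1 := seeleyReflect_apply_sub (σ := σ) (i := i) (c := c) k x
  have h2 : σ * (x i - c) ≤ 0 := (mem_slab.1 hx).1
  simp only [seeleyReflect, Function.update_self] at h1
  rw [mem_ofPred_eq, h1]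
  exact mul_nonneg (by positivity) (by linarith)

theorem continuous_seeleyReflect (k : ℕ) : Continuous (seeleyReflect i c k) :=
  continuous_id.update i (by fun_prop)

theorem seeleyReflect_line (k : ℕ) (x : Fin d → ℝ) (p : Fin d) (t : ℝ) :
    seeleyReflect i c k (x + t • Pi.single p 1) =
      seeleyReflect i c k x + ((if p = i then -2 ^ k else 1) * t) • Pi.single p 1 := by
  ext j
  rcases eq_or_ne p i with rfl | hp
  · rcases eq_or_ne j p with rfl | hj
    · simp [seeleyReflect]; ring
    · simp [seeleyReflect, hj]
  · rcases eq_or_ne j i with rfl | hj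
    · simp [seeleyReflect, hp]
    · simp [seeleyReflect, hj, hp]

/-- On the hyperplane all reflected points coincide with `x`, and the moment identity of order `α i`
sums the coefficients to 1. -/
theorem seeleyExt_eq_self [T2Space F] [ContinuousSMul ℝ F]
    (ha : ∀ n : ℕ, HasSum (fun k => a k * (-2 ^ k) ^ n) 1) {α : Fin d → ℕ} {q : P}
    {x : Fin d → ℝ} (hx : x i = c) : seeleyExt a i c h α q x = h α q x := by
  simp only [seeleyExt, seeleyReflect_of_eq hx]
  simpa using ((ha (α i)).smul_const (h α q x)).tsum_eq

theorem seeleyExt_eq_sum (hvan : ∀ α q x, 1 ≤ σ * (x i - c) → h α q x = 0) {x : Fin d → ℝ} {N : ℕ}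
    (hN : ∀ k, N ≤ k → 1 ≤ 2 ^ k * -(σ * (x i - c))) (α : Fin d → ℕ) (q : P) :
    seeleyExt a i c h α q x =
      ∑ k ∈ Finset.range N, (a k * (-2 ^ k) ^ α i) • h α q (seeleyReflect i c k x) := by
  refine tsum_eq_sum fun k hk => ?_
  rw [hvan, smul_zero]
  rw [seeleyReflect_apply_sub]
  exact hN k (by simpa using hk)

theorem hasSum_seeleyExt [T2Space F] [ContinuousSMul ℝ F] (hσ : σ * σ = 1)
    (ha : ∀ n : ℕ, HasSum (fun k => a k * (-2 ^ k) ^ n) 1)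
    (hvan : ∀ α q x, 1 ≤ σ * (x i - c) → h α q x = 0) {x : Fin d → ℝ} (hx : σ * (x i - c) ≤ 0)
    (α : Fin d → ℕ) (q : P) :
    HasSum (fun k => (a k * (-2 ^ k) ^ α i) • h α q (seeleyReflect i c k x))
      (seeleyExt a i c h α q x) := by
  refine Summable.hasSum ?_
  rcases hx.lt_or_eq with hlt | heq
  · obtain ⟨N, hN⟩ := exists_forall_one_le_two_pow_mul (neg_pos.2 hlt)
    refine summable_of_ne_finset_zero (s := Finset.range N) fun k hk => ?_
    rw [hvan, smul_zero]
    rw [seeleyReflect_apply_sub]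
    exact hN k (by simpa using hk)
  · have hxc : x i = c := by
      have : x i - c = σ * (σ * (x i - c)) := by rw [← mul_assoc, hσ, one_mul]
      rw [heq, mul_zero] at this
      linarith
    simp only [seeleyReflect_of_eq hxc]
    exact ((ha (α i)).smul_const (h α q x)).summable

end SeeleyReflection

section SeeleyExt

variable {d : ℕ} {P F : Type*} [AddCommGroup P] [Module ℝ P] [TopologicalSpace P]
  [AddCommGroup F] [Module ℝ F] [TopologicalSpace F] {a : ℕ → ℝ} {i : Fin d} {σ c : ℝ}
  {h : (Fin d → ℕ) → P → (Fin d → ℝ) → F}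

theorem IsJetOn.isLinearMap_seeleyExt [T2Space F] [IsTopologicalAddGroup F] [ContinuousSMul ℝ F]
    {ℓ : ℕ∞} {B : Fin d → Set ℝ} (hσ : σ * σ = 1)
    (ha : ∀ n : ℕ, HasSum (fun k => a k * (-2 ^ k) ^ n) 1)
    (hvan : ∀ α q x, 1 ≤ σ * (x i - c) → h α q x = 0)
    (hh : IsJetOn ℓ (slab B i {t | 0 ≤ σ * (t - c)}) h) {α : Fin d → ℕ}
    (hα : ((∑ j, α j : ℕ) : ℕ∞) ≤ ℓ) {x : Fin d → ℝ} (hx : x ∈ slab B i {t | σ * (t - c) ≤ 0}) :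
    IsLinearMap ℝ fun q => seeleyExt a i c h α q x := by
  have hS := hasSum_seeleyExt hσ ha hvan (mem_slab.1 hx).1 α
  have hl := fun k => hh.isLinearMap α hα _ (seeleyReflect_mem_slab hx k)
  constructor
  · intro q r
    refine (hS (q + r)).unique (((hS q).add (hS r)).congr_fun fun k => ?_)
    rw [(hl k).map_add, smul_add]
  · intro r q
    refine (hS (r • q)).unique (((hS q).const_smul r).congr_fun fun k => ?_)
    rw [(hl k).map_smul, smul_comm]

/-- Reflected points beyond distance 1 contribute 0. The others lie on a compact segment, so a bound
at `z₀` persists nearby by the tube argument, uniformly in `k`. -/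
theorem IsJetOn.exists_seminorm_bound [ContinuousSMul ℝ F]
    {ℓ : ℕ∞} {B : Fin d → Set ℝ} (hσ : σ * σ = 1)
    (hvan : ∀ α q x, 1 ≤ σ * (x i - c) → h α q x = 0)
    (hh : IsJetOn ℓ (slab B i {t | 0 ≤ σ * (t - c)}) h) {α : Fin d → ℕ}
    (hα : ((∑ j, α j : ℕ) : ℕ∞) ≤ ℓ) (p : Seminorm ℝ F) (hp : Continuous p)
    {z₀ : P × (Fin d → ℝ)} (hz₀ : z₀ ∈ univ ×ˢ slab B i {t | σ * (t - c) ≤ 0}) :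
    ∃ M, ∀ᶠ z in 𝓝[univ ×ˢ slab B i {t | σ * (t - c) ≤ 0}] z₀,
      ∀ k, p (h α z.1 (seeleyReflect i c k z.2)) ≤ M := by
  set A : Set (P × (Fin d → ℝ)) := univ ×ˢ slab B i {t | σ * (t - c) ≤ 0}
  let G : (P × (Fin d → ℝ)) × ℝ → ℝ := fun w =>
    p (h α w.1.1 (Function.update w.1.2 i (c + σ * w.2)))
  have hG : ContinuousOn G (A ×ˢ Icc 0 1) := by
    refine hp.comp_continuousOn ((hh.continuousOn α hα).comp
      (f := fun w : (P × (Fin d → ℝ)) × ℝ => (w.1.1, Function.update w.1.2 i (c + σ * w.2)))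
      ?_ ?_)
    · refine Continuous.continuousOn (Continuous.prodMk (by fun_prop) ?_)
      exact Continuous.update (by fun_prop) i (by fun_prop)
    · rintro ⟨z, t⟩ ⟨hz, ht⟩
      refine ⟨mem_univ _, update_mem_slab hz.2 ?_⟩
      rw [mem_ofPred_eq, add_sub_cancel_left, ← mul_assoc, hσ, one_mul]
      exact ht.1
  obtain ⟨M₀, hM₀⟩ := (isCompact_Icc.image_of_continuousOn
    (hG.comp (f := fun t => (z₀, t)) (by fun_prop) fun t ht => ⟨hz₀, ht⟩)).bddAbove
  -- The summand 1 makes the inequality strict, hence open; the absolute value makes the bound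
  -- nonnegative, as the vanishing terms require.
  refine ⟨|M₀| + 1, ?_⟩
  have hev : ∀ᶠ z in 𝓝 z₀, ∀ t ∈ Icc (0 : ℝ) 1, z ∈ A → t ∈ Icc (0 : ℝ) 1 →
      G (z, t) ≤ |M₀| + 1 := by
    refine isCompact_Icc.eventually_forall_of_forall_eventually
      (P := fun z t => z ∈ A → t ∈ Icc (0 : ℝ) 1 → G (z, t) ≤ |M₀| + 1) fun t ht => ?_
    have h1 : G (z₀, t) < |M₀| + 1 :=
      ((hM₀ ⟨t, ht, rfl⟩).trans (le_abs_self _)).trans_lt (lt_add_one _)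
    have h2 := (hG (z₀, t) ⟨hz₀, ht⟩).eventually_lt_const h1
    filter_upwards [eventually_nhdsWithin_iff.1 h2] with w hw hw1 hw2 using (hw ⟨hw1, hw2⟩).le
  filter_upwards [self_mem_nhdsWithin, mem_nhdsWithin_of_mem_nhds hev] with z hz hzt k
  have ht0 : 0 ≤ 2 ^ k * -(σ * (z.2 i - c)) :=
    mul_nonneg (by positivity) (neg_nonneg.2 (mem_slab.1 hz.2).1)
  rcases le_total (2 ^ k * -(σ * (z.2 i - c))) 1 with h1 | h1
  · have h2 := hzt _ ⟨ht0, h1⟩ hz ⟨ht0, h1⟩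
    have h3 : c + σ * (2 ^ k * -(σ * (z.2 i - c))) = c + -2 ^ k * (z.2 i - c) := by
      linear_combination (-2 ^ k * (z.2 i - c)) * hσ
    simp only [G, h3] at h2
    exact h2
  · rw [hvan _ _ _ (by rwa [seeleyReflect_apply_sub]), map_zero]
    positivity

/-- Dominated convergence is applied to the real numbers `p (k-th difference)` for each seminorm
`p`, with dominating series `|aₖ (-2ᵏ)ⁿ|` times a local bound. -/
theorem IsJetOn.continuousOn_seeleyExt [T2Space F] [IsTopologicalAddGroup F] [ContinuousSMul ℝ F]
    [LocallyConvexSpace ℝ F] {ℓ : ℕ∞} {B : Fin d → Set ℝ} (hσ : σ * σ = 1)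
    (hs : ∀ n : ℕ, Summable (fun k => |a k * (-2 ^ k) ^ n|))
    (ha : ∀ n : ℕ, HasSum (fun k => a k * (-2 ^ k) ^ n) 1)
    (hvan : ∀ α q x, 1 ≤ σ * (x i - c) → h α q x = 0)
    (hh : IsJetOn ℓ (slab B i {t | 0 ≤ σ * (t - c)}) h) {α : Fin d → ℕ}
    (hα : ((∑ j, α j : ℕ) : ℕ∞) ≤ ℓ) :
    ContinuousOn (fun z : P × (Fin d → ℝ) => seeleyExt a i c h α z.1 z.2)
      (univ ×ˢ slab B i {t | σ * (t - c) ≤ 0}) := by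
  intro z₀ hz₀
  have hp := with_gaugeSeminormFamily (𝕜 := ℝ) (E := F)
  refine (hp.tendsto_nhds _ _).2 fun j ε hε => ?_
  set p := gaugeSeminormFamily ℝ F j
  have hpc : Continuous p := hp.continuous_seminorm j
  obtain ⟨M, hM⟩ := hh.exists_seminorm_bound hσ hvan hα p hpc hz₀
  have hM₀ := hM.self_of_nhdsWithin hz₀
  set A : Set (P × (Fin d → ℝ)) := univ ×ˢ slab B i {t | σ * (t - c) ≤ 0}
  have hT : ∀ k, ContinuousOn
      (fun z : P × (Fin d → ℝ) => h α z.1 (seeleyReflect i c k z.2)) A := fun k =>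
    (hh.continuousOn α hα).comp (f := fun z : P × (Fin d → ℝ) => (z.1, seeleyReflect i c k z.2))
      (continuous_fst.prodMk ((continuous_seeleyReflect k).comp continuous_snd)).continuousOn
      fun z hz => ⟨mem_univ _, seeleyReflect_mem_slab hz.2 k⟩
  have hbd : ∀ᶠ z in 𝓝[A] z₀, ∀ k, p ((a k * (-2 ^ k) ^ α i) •
      (h α z.1 (seeleyReflect i c k z.2) - h α z₀.1 (seeleyReflect i c k z₀.2))) ≤
        |a k * (-2 ^ k) ^ α i| * (M + M) := by
    filter_upwards [hM] with z hz k
    rw [map_smul_eq_mul, Real.norm_eq_abs]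
    exact mul_le_mul_of_nonneg_left ((map_sub_le_add p _ _).trans (add_le_add (hz k) (hM₀ k)))
      (abs_nonneg _)
  have hsum : Summable fun k => |a k * (-2 ^ k) ^ α i| * (M + M) := (hs (α i)).mul_right _
  have hlim := tendsto_tsum_of_dominated_convergence (𝓕 := 𝓝[A] z₀)
    (f := fun z k => p ((a k * (-2 ^ k) ^ α i) •
      (h α z.1 (seeleyReflect i c k z.2) - h α z₀.1 (seeleyReflect i c k z₀.2))))
    (g := fun _ => 0) hsum
    (fun k => by
      have h1 : Tendsto (fun z : P × (Fin d → ℝ) => (a k * (-2 ^ k) ^ α i) •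
          (h α z.1 (seeleyReflect i c k z.2) - h α z₀.1 (seeleyReflect i c k z₀.2)))
          (𝓝[A] z₀) (𝓝 0) := by
        simpa using ((hT k z₀ hz₀).tendsto.sub_const
          (h α z₀.1 (seeleyReflect i c k z₀.2))).const_smul (a k * (-2 ^ k) ^ α i)
      simpa [Function.comp_def] using (hpc.tendsto 0).comp h1)
    (hbd.mono fun z hz k => by rw [Real.norm_of_nonneg (apply_nonneg p _)]; exact hz k)
  rw [tsum_zero] at hlim
  filter_upwards [hlim.eventually_lt_const hε, hbd, self_mem_nhdsWithin] with z hz hzb hzA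
  refine lt_of_le_of_lt (p.le_tsum_of_hasSum hpc ?_ (hsum.of_nonneg_of_le
    (fun k => apply_nonneg p _) hzb)) hz
  simp only [smul_sub]
  exact (hasSum_seeleyExt hσ ha hvan (mem_slab.1 hzA.2).1 α z.1).sub
    (hasSum_seeleyExt hσ ha hvan (mem_slab.1 hz₀.2).1 α z₀.1)

theorem IsJetOn.hasPartialDerivAt_seeleyExt [IsTopologicalAddGroup F]
    [ContinuousSMul ℝ F] {ℓ : ℕ∞} {B : Fin d → Set ℝ}
    (hvan : ∀ α q x, 1 ≤ σ * (x i - c) → h α q x = 0)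
    (hh : IsJetOn ℓ (slab B i {t | 0 ≤ σ * (t - c)}) h) {α : Fin d → ℕ} {p : Fin d}
    (hp : ∀ j < p, α j = 0) (hα : ((∑ j, (α + Pi.single p 1 : Fin d → ℕ) j : ℕ) : ℕ∞) ≤ ℓ) (q : P)
    {x : Fin d → ℝ} (hx : x ∈ slab (fun j => interior (B j)) i {t | σ * (t - c) < 0}) :
    HasPartialDerivAt (seeleyExt a i c h α q) p x (seeleyExt a i c h (α + Pi.single p 1) q x) := by
  have hneg : σ * (x i - c) < 0 := (mem_slab.1 hx).1
  -- Half the distance of `x` is used so that the same `N` truncates the series at all points near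
  -- `x`.
  obtain ⟨N, hN⟩ := exists_forall_one_le_two_pow_mul (half_pos (neg_pos.2 hneg))
  have hN' : ∀ y : Fin d → ℝ, σ * (y i - c) ≤ σ * (x i - c) / 2 →
      ∀ k, N ≤ k → 1 ≤ 2 ^ k * -(σ * (y i - c)) := fun y hy k hk =>
    (hN k hk).trans (mul_le_mul_of_nonneg_left (by linarith) (by positivity))
  have hint : ∀ k, seeleyReflect i c k x ∈ interior (slab B i {t | 0 ≤ σ * (t - c)}) := by
    intro k
    rw [interior_slab]
    refine update_mem_slab hx ?_
    have ho : IsOpen {t : ℝ | 0 < σ * (t - c)} := isOpen_lt continuous_const (by fun_prop)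
    have hsub : {t : ℝ | 0 < σ * (t - c)} ⊆ {t | 0 ≤ σ * (t - c)} := by
      intro t ht
      rw [mem_ofPred_eq] at ht ⊢
      exact ht.le
    refine interior_maximal hsub ho ?_
    have h1 := seeleyReflect_apply_sub (σ := σ) (i := i) (c := c) k x
    simp only [seeleyReflect, Function.update_self] at h1
    rw [mem_ofPred_eq, h1]
    exact mul_pos (by positivity) (by linarith)
  rw [seeleyExt_eq_sum hvan (hN' x (by linarith))]
  have key := HasPartialDerivAt.sum (s := Finset.range N) fun k _ =>
    ((hh.hasPartialDerivAt α p hp hα q _ (hint k)).comp_affine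
      (β := if p = i then -2 ^ k else 1) (by split_ifs <;> simp)
      (seeleyReflect_line k x p)).const_smul (a k * (-2 ^ k) ^ α i)
  -- The chain-rule factor `-2 ^ k` raises the exponent in the weight from `α i` to `α i + 1`.
  have hval : ∀ k, (a k * (-2 ^ k) ^ α i) • ((if p = i then -2 ^ k else 1 : ℝ) •
      h (α + Pi.single p 1) q (seeleyReflect i c k x)) =
      (a k * (-2 ^ k) ^ (α + Pi.single p 1 : Fin d → ℕ) i) •
        h (α + Pi.single p 1) q (seeleyReflect i c k x) := by
    intro k
    rw [smul_smul]
    congr 1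
    split_ifs with hpi
    · subst hpi
      rw [Pi.add_apply, Pi.single_eq_same, pow_succ, mul_assoc]
    · rw [Pi.add_apply, Pi.single_eq_of_ne' hpi, add_zero, mul_one]
  simp only [hval] at key
  refine key.congr_of_eventuallyEq ?_
  have ho : IsOpen {y : Fin d → ℝ | σ * (y i - c) < σ * (x i - c) / 2} :=
    isOpen_lt (by fun_prop) continuous_const
  filter_upwards [ho.mem_nhds (by simp only [mem_ofPred_eq]; linarith)] with y hy
  exact seeleyExt_eq_sum hvan (hN' y (le_of_lt hy)) α q

end SeeleyExt

/-! ### Gluing, and extension one coordinate at a time. -/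

section Extension

variable {d : ℕ} {P F : Type*} [AddCommGroup P] [Module ℝ P] [TopologicalSpace P]
  [AddCommGroup F] [Module ℝ F] [TopologicalSpace F]

/-- A jet on the part `σ (xᵢ - c) ≥ 0` and a jet on the part `σ (xᵢ - c) < 0` of a slab, with
matching values on the interface, form a jet. -/
theorem IsJetOn.glue [IsTopologicalAddGroup F] [ContinuousSMul ℝ F] [LocallyConvexSpace ℝ F]
    {ℓ : ℕ∞} {B : Fin d → Set ℝ} {i : Fin d} {J : Set ℝ} {σ c : ℝ} (hσ : σ * σ = 1)
    {f S : (Fin d → ℕ) → P → (Fin d → ℝ) → F}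
    (hf : IsJetOn ℓ (slab B i (J ∩ {t | 0 ≤ σ * (t - c)})) f)
    (hSl : ∀ α : Fin d → ℕ, ((∑ j, α j : ℕ) : ℕ∞) ≤ ℓ → ∀ x ∈ slab B i {t | σ * (t - c) ≤ 0},
      IsLinearMap ℝ fun q => S α q x)
    (hSc : ∀ α : Fin d → ℕ, ((∑ j, α j : ℕ) : ℕ∞) ≤ ℓ →
      ContinuousOn (fun z : P × (Fin d → ℝ) => S α z.1 z.2)
        (univ ×ˢ slab B i {t | σ * (t - c) ≤ 0}))
    (hSd : ∀ (α : Fin d → ℕ) (p : Fin d), (∀ j < p, α j = 0) →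
      ((∑ j, (α + Pi.single p 1 : Fin d → ℕ) j : ℕ) : ℕ∞) ≤ ℓ → ∀ q,
        ∀ x ∈ slab (fun j => interior (B j)) i {t | σ * (t - c) < 0},
          HasPartialDerivAt (S α q) p x (S (α + Pi.single p 1) q x))
    (hfS : ∀ α q, ∀ x ∈ slab B i J, x i = c → S α q x = f α q x) :
    IsJetOn ℓ (slab B i J)
      fun α q x => open scoped Classical in if 0 ≤ σ * (x i - c) then f α q x else S α q x := by
  classical
  have hpos : ∀ x ∈ slab B i J, 0 ≤ σ * (x i - c) → x ∈ slab B i (J ∩ {t | 0 ≤ σ * (t - c)}) :=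
    fun x hx h => mem_slab.2 ⟨⟨(mem_slab.1 hx).1, h⟩, (mem_slab.1 hx).2⟩
  have hneg : ∀ x ∈ slab B i J, σ * (x i - c) ≤ 0 → x ∈ slab B i {t | σ * (t - c) ≤ 0} :=
    fun x hx h => mem_slab.2 ⟨h, (mem_slab.1 hx).2⟩
  have hzero : ∀ x : Fin d → ℝ, σ * (x i - c) = 0 → x i = c := fun x h => by
    have h1 : σ ≠ 0 := by rintro rfl; simp at hσ
    have := (mul_eq_zero.1 h).resolve_left h1
    linarith
  have hcont : ∀ α : Fin d → ℕ, ((∑ j, α j : ℕ) : ℕ∞) ≤ ℓ →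
      ContinuousOn (fun z : P × (Fin d → ℝ) =>
        if 0 ≤ σ * (z.2 i - c) then f α z.1 z.2 else S α z.1 z.2) (univ ×ˢ slab B i J) := by
    intro α hα
    have hcs : Continuous fun z : P × (Fin d → ℝ) => σ * (z.2 i - c) := by fun_prop
    refine ContinuousOn.if ?_ ?_ ?_
    · rintro z ⟨hz, hzf⟩
      have h0 : 0 = σ * (z.2 i - c) := frontier_le_subset_eq continuous_const hcs hzf
      exact (hfS α z.1 z.2 hz.2 (hzero _ h0.symm)).symm
    · rw [(isClosed_le continuous_const hcs).closure_eq]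
      exact (hf.continuousOn α hα).mono fun z hz => ⟨mem_univ _, hpos _ hz.1.2 hz.2⟩
    · refine (hSc α hα).mono fun z hz => ⟨mem_univ _, hneg _ hz.1.2 ?_⟩
      have hcl : closure {z : P × (Fin d → ℝ) | ¬0 ≤ σ * (z.2 i - c)} ⊆
          {z | σ * (z.2 i - c) ≤ 0} :=
        closure_minimal (fun z hz => le_of_not_ge hz) (isClosed_le hcs continuous_const)
      exact hcl hz.2
  refine ⟨fun α hα x hx => ?_, hcont, fun α p hp hα q => ?_⟩
  · by_cases h : 0 ≤ σ * (x i - c)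
    · simpa only [if_pos h] using hf.isLinearMap α hα x (hpos x hx h)
    · simpa only [if_neg h] using hSl α hα x (hneg x hx (le_of_not_ge h))
  · have hline : ∀ α : Fin d → ℕ, ((∑ j, α j : ℕ) : ℕ∞) ≤ ℓ → ContinuousOn (fun x =>
        if 0 ≤ σ * (x i - c) then f α q x else S α q x) (interior (slab B i J)) := fun α hα =>
      (hcont α hα).comp (f := fun x => (q, x)) (by fun_prop)
        fun x hx => ⟨mem_univ _, interior_subset hx⟩
    refine hasPartialDerivAt_of_off_hyperplane (i := i) (c := c) isOpen_interior
      (hline α (degree_le_of_le (fun j => Nat.le_add_right _ _) hα)) (hline _ hα)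
      fun x hx hxc => ?_
    rcases lt_or_gt_of_ne fun h => hxc (hzero x h) with h | h
    · have ho : IsOpen {x : Fin d → ℝ | σ * (x i - c) < 0} := isOpen_lt (by fun_prop) continuous_const
      rw [if_neg h.not_ge]
      refine (hSd α p hp hα q x ?_).congr_of_eventuallyEq ?_
      · rw [interior_slab, mem_slab] at hx
        exact mem_slab.2 ⟨h, hx.2⟩
      · filter_upwards [ho.mem_nhds h] with y hy
        exact if_neg (not_le.2 hy)
    · have ho : IsOpen {x : Fin d → ℝ | 0 < σ * (x i - c)} := isOpen_lt continuous_const (by fun_prop)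
      rw [if_pos h.le]
      refine (hf.hasPartialDerivAt α p hp hα q x ?_).congr_of_eventuallyEq ?_
      · exact interior_maximal (fun y hy => hpos y (interior_subset hy.1) (le_of_lt hy.2))
          (isOpen_interior.inter ho) ⟨hx, h⟩
      · filter_upwards [ho.mem_nhds h] with y hy
        exact if_pos (le_of_lt hy)

variable (P F) in
/-- Every jet on `R` extends to a jet on `R'`. -/
def JetsExtend (ℓ : ℕ∞) (R R' : Set (Fin d → ℝ)) : Prop :=
  R ⊆ R' ∧ ∀ f : (Fin d → ℕ) → P → (Fin d → ℝ) → F, IsJetOn ℓ R f →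
    ∃ f', IsJetOn ℓ R' f' ∧ ∀ q, ∀ x ∈ R, f' 0 q x = f 0 q x

theorem JetsExtend.refl (ℓ : ℕ∞) (R : Set (Fin d → ℝ)) : JetsExtend P F ℓ R R :=
  ⟨Subset.rfl, fun f hf => ⟨f, hf, fun _ _ _ => rfl⟩⟩

theorem JetsExtend.trans {ℓ : ℕ∞} {R₁ R₂ R₃ : Set (Fin d → ℝ)} (h₁ : JetsExtend P F ℓ R₁ R₂)
    (h₂ : JetsExtend P F ℓ R₂ R₃) : JetsExtend P F ℓ R₁ R₃ := by
  refine ⟨h₁.1.trans h₂.1, fun f hf => ?_⟩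
  obtain ⟨f', hf', he⟩ := h₁.2 f hf
  obtain ⟨f'', hf'', he'⟩ := h₂.2 f' hf'
  exact ⟨f'', hf'', fun q x hx => (he' q x (h₁.1 hx)).trans (he q x hx)⟩

variable [T2Space F] [IsTopologicalAddGroup F] [ContinuousSMul ℝ F] [LocallyConvexSpace ℝ F]

/-- The original jet is kept on its side and glued to the Seeley series of its cutoff; the two agree
on the hyperplane because `χ` is flat there and all moments are 1. Only a collar of width 1 is
needed on the given side. -/
theorem jetsExtend_slab_halfLine (ℓ : ℕ∞) (B : Fin d → Set ℝ) (i : Fin d) {J : Set ℝ} {σ c : ℝ}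
    (hσ : σ * σ = 1) (hJ : ∀ t, 0 ≤ σ * (t - c) → σ * (t - c) < 1 → t ∈ J) :
    JetsExtend P F ℓ (slab B i (J ∩ {t | 0 ≤ σ * (t - c)})) (slab B i J) := by
  classical
  refine ⟨fun x hx => mem_slab.2 ⟨(mem_slab.1 hx).1.1, (mem_slab.1 hx).2⟩, fun f hf => ?_⟩
  obtain ⟨a, ha⟩ := exists_seeley_sequence
  obtain ⟨χ, hχ, hχc, hχ0⟩ := exists_smooth_cutoff c
  have hχ0' : ∀ n t, 1 / 2 < σ * (t - c) → iteratedDeriv n χ t = 0 := fun n t ht => by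
    refine hχ0 n t (ht.trans_le ((le_abs_self _).trans ?_))
    have hσ1 : |σ| * |σ| = 1 := by rw [← abs_mul, hσ, abs_one]
    have : |σ| = 1 := by nlinarith [abs_nonneg σ]
    rw [abs_mul, this, one_mul]
  have hvan : ∀ α q x, 1 ≤ σ * (x i - c) → cutoffJet χ i f α q x = 0 := fun α q x hx =>
    cutoffJet_eq_zero fun n => hχ0' n _ (by linarith)
  have hh := hf.cutoffJet hJ hχ hχ0'
  refine ⟨_, hf.glue hσ (S := seeleyExt a i c (cutoffJet χ i f))
    (fun α hα x hx => hh.isLinearMap_seeleyExt hσ (fun n => (ha n).2) hvan hα hx)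
    (fun α hα => hh.continuousOn_seeleyExt hσ (fun n => (ha n).1) (fun n => (ha n).2) hvan hα)
    (fun α p hp hα q x hx => hh.hasPartialDerivAt_seeleyExt hvan hp hα q hx)
    (fun α q x _ hxc => ?_), fun q x hx => if_pos (mem_slab.1 hx).1.2⟩
  rw [seeleyExt_eq_self (fun n => (ha n).2) hxc]
  exact cutoffJet_eq_self fun n => by rw [hxc, hχc]

theorem jetsExtend_slab_Ici (ℓ : ℕ∞) (B : Fin d → Set ℝ) (i : Fin d) :
    JetsExtend P F ℓ (slab B i (Ici 0)) (slab B i univ) := by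
  have h := jetsExtend_slab_halfLine (P := P) (F := F) ℓ B i (J := univ) (σ := 1) (c := 0)
    (by norm_num) fun _ _ _ => mem_univ _
  convert h using 2
  ext t
  simp

/-- Reflecting at 0 extends to `]-∞, 1]`; reflecting at 1 with `σ = -1` then extends to the whole
line. -/
theorem jetsExtend_slab_Icc (ℓ : ℕ∞) (B : Fin d → Set ℝ) (i : Fin d) :
    JetsExtend P F ℓ (slab B i (Icc 0 1)) (slab B i univ) := by
  have h₁ := jetsExtend_slab_halfLine (P := P) (F := F) ℓ B i (J := Iic 1) (σ := 1) (c := 0)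
    (by norm_num) fun t _ ht => by simp only [mem_Iic]; linarith
  have h₂ := jetsExtend_slab_halfLine (P := P) (F := F) ℓ B i (J := univ) (σ := -1) (c := 1)
    (by norm_num) fun _ _ _ => mem_univ _
  have e₁ : Iic 1 ∩ {t : ℝ | 0 ≤ 1 * (t - 0)} = Icc 0 1 := by
    ext t
    simp [and_comm]
  have e₂ : univ ∩ {t : ℝ | 0 ≤ -1 * (t - 1)} = Iic 1 := by
    ext t
    simp
  rw [e₁] at h₁
  rw [e₂] at h₂
  exact h₁.trans h₂

theorem jetsExtend_pi (ℓ : ℕ∞) (I : Fin d → Set ℝ)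
    (hI : ∀ i, I i = univ ∨ I i = Ici 0 ∨ I i = Icc 0 1) :
    JetsExtend P F ℓ (Set.pi univ I) univ := by
  have key : ∀ s : Finset (Fin d), JetsExtend P F ℓ (Set.pi univ I)
      (Set.pi univ fun j => if j ∈ s then univ else I j) := by
    intro s
    induction s using Finset.induction_on with
    | empty => simpa using JetsExtend.refl ℓ (Set.pi univ I)
    | insert i s hi ih =>
      set B : Fin d → Set ℝ := fun j => if j ∈ s then univ else I j with hB
      have hBi : B i = I i := by simp [hB, hi]
      have h₁ : slab B i (I i) = Set.pi univ B := by rw [slab, ← hBi, Function.update_eq_self]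
      have h₂ : slab B i univ = Set.pi univ fun j => if j ∈ insert i s then univ else I j := by
        rw [slab]
        congr 1
        ext1 j
        rcases eq_or_ne j i with rfl | hj
        · simp
        · simp [hj, hB]
      refine ih.trans ?_
      rw [← h₁, ← h₂]
      rcases hI i with h | h | h <;> rw [h]
      · exact JetsExtend.refl ℓ _
      · exact jetsExtend_slab_Ici ℓ B i
      · exact jetsExtend_slab_Icc ℓ B i
  simpa using key Finset.univ

end Extension

/-! ### Multi-indices as sorted words. -/

section MultiIndex

variable {d : ℕ}

theorem multiIndexWord_zero : multiIndexWord (0 : Fin d → ℕ) = [] := by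
  simp [multiIndexWord]

/-- The blocks before `p` are empty, so the additional letter `p` stands at the head of the word. -/
theorem multiIndexWord_add_single {α : Fin d → ℕ} {p : Fin d} (hp : ∀ j < p, α j = 0) :
    multiIndexWord (α + Pi.single p 1) = p :: multiIndexWord α := by
  have key : ∀ L : List (Fin d), L.Pairwise (· < ·) → p ∈ L →
      (L.flatMap fun i => List.replicate ((α + Pi.single p 1 : Fin d → ℕ) i) i) =
        p :: L.flatMap fun i => List.replicate (α i) i := by
    intro L
    induction L with
    | nil => intro _ h; simp at h
    | cons b L ih =>
      intro hL hpL
      rw [List.pairwise_cons] at hL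
      rcases eq_or_ne p b with rfl | hpb
      · have hrest : (L.flatMap fun i => List.replicate ((α + Pi.single p 1 : Fin d → ℕ) i) i) =
            L.flatMap fun i => List.replicate (α i) i :=
          List.flatMap_congr fun i hi => by
            rw [Pi.add_apply, Pi.single_eq_of_ne (hL.1 i hi).ne', add_zero]
        rw [List.flatMap_cons, List.flatMap_cons, hrest, Pi.add_apply, Pi.single_eq_same,
          List.replicate_succ, List.cons_append]
      · have hpL' : p ∈ L := (List.mem_cons.1 hpL).resolve_left hpb
        rw [List.flatMap_cons, List.flatMap_cons, ih hL.2 hpL', Pi.add_apply,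
          Pi.single_eq_of_ne' hpb, hp b (hL.1 p hpL')]
        simp
  exact key _ (List.pairwise_lt_finRange d) (List.mem_finRange p)

theorem exists_eq_add_single {α : Fin d → ℕ} (hα : α ≠ 0) :
    ∃ (β : Fin d → ℕ) (p : Fin d), (∀ j < p, β j = 0) ∧ α = β + Pi.single p 1 := by
  have hne : {p : Fin d | α p ≠ 0}.Nonempty := Function.ne_iff.1 hα
  obtain ⟨p, hp, hmin⟩ := (wellFounded_lt (α := Fin d)).has_min _ hne
  have hzero : ∀ j < p, α j = 0 := fun j hj => by
    by_contra h
    exact hmin j h hj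
  refine ⟨α - Pi.single p 1, p, fun j hj => by simp [hzero j hj], ?_⟩
  ext j
  rcases eq_or_ne j p with rfl | hj
  · have : α j ≠ 0 := hp
    simp
    omega
  · simp [hj]

end MultiIndex

theorem IsJetOn.hasMultiPartialOn {d : ℕ} {P F : Type*} [AddCommGroup P] [Module ℝ P]
    [TopologicalSpace P] [AddCommGroup F] [Module ℝ F] [TopologicalSpace F] {ℓ : ℕ∞}
    {R : Set (Fin d → ℝ)} {f : (Fin d → ℕ) → P → (Fin d → ℝ) → F} (hf : IsJetOn ℓ R f) (q : P)
    (α : Fin d → ℕ) (hα : ((∑ j, α j : ℕ) : ℕ∞) ≤ ℓ) :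
    HasMultiPartialOn (interior R) α (f 0 q) (f α q) := by
  induction hn : ∑ j, α j generalizing α with
  | zero =>
    have : α = 0 := funext fun j => (Finset.sum_eq_zero_iff.1 hn) j (Finset.mem_univ j)
    rw [this, HasMultiPartialOn, multiIndexWord_zero]
    exact fun _ _ => rfl
  | succ n ih =>
    obtain ⟨β, p, hβ, rfl⟩ := exists_eq_add_single (α := α) fun h => by simp [h] at hn
    rw [HasMultiPartialOn, multiIndexWord_add_single hβ]
    refine ⟨f β q, ih β (degree_le_of_le (fun j => Nat.le_add_right _ _) hα) ?_,
      hf.hasPartialDerivAt β p hβ hα q⟩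
    simpa [Finset.sum_add_distrib] using hn

/-! ### From jets to continuous linear extension operators. -/

namespace CkMap

variable {d : ℕ} {ℓ : ℕ∞} {R : Set (Fin d → ℝ)} {F : Type*} [AddCommGroup F] [Module ℝ F]
  [TopologicalSpace F] [IsTopologicalAddGroup F] [ContinuousSMul ℝ F]

theorem continuous_partialDeriv (α : Fin d → ℕ) (hα : ((∑ i, α i : ℕ) : ℕ∞) ≤ ℓ) :
    Continuous fun γ : CkMap ℓ R F => γ.partialDeriv α hα :=
  continuous_iInf_dom (continuous_iInf_dom (i := hα) continuous_induced_dom)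

theorem partialDeriv_zero [T2Space F] (hR : R ⊆ closure (interior R))
    (h0 : ((∑ i, (0 : Fin d → ℕ) i : ℕ) : ℕ∞) ≤ ℓ) (γ : CkMap ℓ R F) :
    γ.partialDeriv 0 h0 = γ.toContinuousMap := by
  refine (partialDeriv_unique hR 0 h0 γ ?_).symm
  rw [IsPartialExtension, HasMultiPartialOn, multiIndexWord_zero]
  exact fun _ _ => rfl

/-- `partialDeriv` is a choice, so its linearity rests on uniqueness of the continuous extension,
that is, on density of the interior. -/
theorem isLinearMap_partialDeriv [T2Space F] (hR : R ⊆ closure (interior R)) (α : Fin d → ℕ)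
    (hα : ((∑ i, α i : ℕ) : ℕ∞) ≤ ℓ) :
    IsLinearMap ℝ fun γ : CkMap ℓ R F => γ.partialDeriv α hα := by
  constructor
  · intro γ η
    refine (partialDeriv_unique hR α hα _ ?_).symm
    refine (HasIterPartialOn.add (γ.partialDeriv_spec α hα)
      (η.partialDeriv_spec α hα)).congr_mono Subset.rfl ?_ ?_ <;>
    · intro x hx
      simp only [zeroExt_apply _ (interior_subset hx)]
      rfl
  · intro r γ
    refine (partialDeriv_unique hR α hα _ ?_).symm
    refine (HasIterPartialOn.smul r (γ.partialDeriv_spec α hα)).congr_mono Subset.rfl ?_ ?_ <;>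
    · intro x hx
      simp only [zeroExt_apply _ (interior_subset hx)]
      rfl

variable (ℓ R F) in
/-- The partial derivatives of `γ`, as functions of `γ ∈ C^ℓ(R, F)` and `x ∈ ℝᵈ`. -/
def jet (α : Fin d → ℕ) (γ : CkMap ℓ R F) (x : Fin d → ℝ) : F :=
  open scoped Classical in
  if hα : ((∑ i, α i : ℕ) : ℕ∞) ≤ ℓ then zeroExt (γ.partialDeriv α hα) x else 0

theorem jet_eq {α : Fin d → ℕ} (hα : ((∑ i, α i : ℕ) : ℕ∞) ≤ ℓ) (γ : CkMap ℓ R F) :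
    jet ℓ R F α γ = zeroExt (γ.partialDeriv α hα) :=
  funext fun _ => dif_pos hα

theorem isJetOn_jet [T2Space F] [LocallyCompactSpace R] (hR : R ⊆ closure (interior R)) :
    IsJetOn ℓ R (jet ℓ R F) := by
  refine ⟨fun α hα x hx => ?_, fun α hα => ?_, fun α p hp hα γ x hx => ?_⟩
  · simp only [jet_eq hα, zeroExt_apply _ hx]
    have h := isLinearMap_partialDeriv (F := F) hR α hα
    exact ⟨fun γ η => by rw [h.map_add]; rfl, fun r γ => by rw [h.map_smul]; rfl⟩
  · rw [continuousOn_iff_continuous_domRestrict]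
    -- Local compactness of `R` enters here: it makes evaluation `C(R, F) × R → F` continuous.
    have h1 : Continuous fun w : CkMap ℓ R F × R => w.1.partialDeriv α hα w.2 :=
      ((continuous_partialDeriv α hα).comp continuous_fst).eval continuous_snd
    have h2 : Continuous fun z : (univ ×ˢ R : Set (CkMap ℓ R F × (Fin d → ℝ))) =>
        (z.1.1, (⟨z.1.2, z.2.2⟩ : R)) := by fun_prop
    refine (h1.comp h2).congr fun z => ?_
    simp only [Function.comp_apply, Set.domRestrict_apply, jet_eq hα, zeroExt_apply _ z.2.2]
  · have hα' : ((∑ i, α i : ℕ) : ℕ∞) ≤ ℓ := degree_le_of_le (fun j => Nat.le_add_right _ _) hα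
    rw [jet_eq hα, jet_eq hα']
    have h := γ.partialDeriv_spec _ hα
    rw [IsPartialExtension, HasMultiPartialOn, multiIndexWord_add_single hp] at h
    obtain ⟨k, hk, hk'⟩ := h
    refine (hk' x hx).congr_of_eventuallyEq ?_
    filter_upwards [isOpen_interior.mem_nhds hx] with y hy
    exact HasIterPartialOn.unique isOpen_interior (γ.partialDeriv_spec α hα') hk y hy

/-- If jets on `R` extend to `ℝᵈ`, then the restriction map `C^ℓ(ℝᵈ, F) → C^ℓ(R, F)` has a continuous
linear right inverse. -/
theorem exists_rightInverse_restrict [T2Space F] [LocallyCompactSpace R]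
    (hR : R ⊆ closure (interior R)) (h : JetsExtend (CkMap ℓ R F) F ℓ R univ) :
    ∃ E : CkMap ℓ R F →L[ℝ] CkMap ℓ (univ : Set (Fin d → ℝ)) F,
      Function.RightInverse E (restrict (subset_univ R)) := by
  obtain ⟨f, hf, hf0⟩ := h.2 _ (isJetOn_jet hR)
  have h0 : ((∑ i, (0 : Fin d → ℕ) i : ℕ) : ℕ∞) ≤ ℓ := by simp
  have hc : ∀ α : Fin d → ℕ, ((∑ i, α i : ℕ) : ℕ∞) ≤ ℓ →
      Continuous fun w : CkMap ℓ R F × (univ : Set (Fin d → ℝ)) => f α w.1 w.2 := by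
    intro α hα
    exact (hf.continuousOn α hα).comp_continuous
      (f := fun w : CkMap ℓ R F × (univ : Set (Fin d → ℝ)) => (w.1, (w.2 : Fin d → ℝ)))
      (by fun_prop) fun w => ⟨mem_univ _, mem_univ _⟩
  let g : ∀ α : Fin d → ℕ, ((∑ i, α i : ℕ) : ℕ∞) ≤ ℓ → CkMap ℓ R F → C((univ : Set (Fin d → ℝ)), F) :=
    fun α hα γ => ⟨fun x => f α γ x, (hc α hα).comp (by fun_prop : Continuous fun x => (γ, x))⟩
  have hext : ∀ α hα γ, IsPartialExtension α (g 0 h0 γ) (g α hα γ) := fun α hα γ =>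
    HasIterPartialOn.congr_mono (hf.hasMultiPartialOn γ α hα) Subset.rfl
      (fun x _ => (zeroExt_apply (g 0 h0 γ) (mem_univ x)).symm)
      (fun x _ => (zeroExt_apply (g α hα γ) (mem_univ x)).symm)
  let E : CkMap ℓ R F →ₗ[ℝ] CkMap ℓ (univ : Set (Fin d → ℝ)) F :=
    { toFun := fun γ => ⟨g 0 h0 γ, fun α hα => ⟨g α hα γ, hext α hα γ⟩⟩
      map_add' := fun γ η => Subtype.ext (ContinuousMap.ext fun x =>
        (hf.isLinearMap 0 h0 x (mem_univ _)).map_add γ η)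
      map_smul' := fun r γ => Subtype.ext (ContinuousMap.ext fun x =>
        (hf.isLinearMap 0 h0 x (mem_univ _)).map_smul r γ) }
  have hE : Continuous E := by
    refine continuous_iInf_rng.2 fun α => continuous_iInf_rng.2 fun hα =>
      continuous_induced_rng.2 ?_
    -- By uniqueness `∂^α (E γ)` is the extended jet of order `α`, so continuity of `∂^α ∘ E` into
    -- the compact-open topology follows by currying.
    have he : (fun γ : CkMap ℓ (univ : Set (Fin d → ℝ)) F => γ.partialDeriv α hα) ∘ E = g α hα :=
      funext fun γ => (partialDeriv_unique (by simp) α hα (E γ) (hext α hα γ)).symm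
    rw [he]
    exact ContinuousMap.continuous_of_continuous_uncurry _ (hc α hα)
  refine ⟨⟨E, hE⟩, fun γ => Subtype.ext (ContinuousMap.ext fun x => ?_)⟩
  have h1 := hf0 γ x x.2
  rw [jet_eq h0, zeroExt_apply _ x.2, partialDeriv_zero hR] at h1
  exact h1

/-- The extension theorem for products of the intervals `ℝ`, `[0, ∞[` and `[0, 1]`. -/
theorem exists_rightInverse_restrict_of_eq_pi [T2Space F] [LocallyConvexSpace ℝ F]
    (I : Fin d → Set ℝ) (hI : ∀ i, I i = univ ∨ I i = Ici 0 ∨ I i = Icc 0 1)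
    (hRI : R = Set.pi univ I) :
    ∃ E : CkMap ℓ R F →L[ℝ] CkMap ℓ (univ : Set (Fin d → ℝ)) F,
      Function.RightInverse E (restrict (subset_univ R)) := by
  have hcl : ∀ i, IsClosed (I i) := fun i => by
    rcases hI i with h | h | h <;> rw [h]
    exacts [isClosed_univ, isClosed_Ici, isClosed_Icc]
  have hint : ∀ i, I i ⊆ closure (interior (I i)) := fun i => by
    rcases hI i with h | h | h <;> rw [h]
    · simp
    · rw [interior_Ici, closure_Ioi]
    · rw [interior_Icc, closure_Ioo (by norm_num)]
  have hR : R ⊆ closure (interior R) := by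
    rw [hRI, interior_pi_set finite_univ, closure_pi_set]
    exact Set.pi_mono fun i _ => hint i
  have : LocallyCompactSpace R := by
    rw [hRI]
    exact (isClosed_set_pi fun i _ => hcl i).locallyCompactSpace
  exact exists_rightInverse_restrict hR (by rw [hRI]; exact jetsExtend_pi ℓ I hI)

end CkMap

theorem orthant_eq_pi (d m : ℕ) :
    orthant d m = Set.pi univ fun i : Fin d => if (i : ℕ) < m then Ici 0 else univ := by
  ext x
  simp only [orthant, mem_univ_pi]
  refine forall_congr' fun i => ?_
  split_ifs with h <;> simp [h]

end

theorem corollary1p8 (ℓ : ℕ∞) (d m : ℕ) (hd : 1 ≤ d) (hm : m ≤ d)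
    (F : Type*) [AddCommGroup F] [Module ℝ F] [TopologicalSpace F] [IsTopologicalAddGroup F]
    [ContinuousSMul ℝ F] [LocallyConvexSpace ℝ F] [T2Space F] :
    (∃ E : CkMap ℓ (orthant d m) F →L[ℝ] CkMap ℓ (Set.univ : Set (Fin d → ℝ)) F,
      Function.RightInverse E (CkMap.restrict (Set.subset_univ (orthant d m)))) ∧
    (∃ E : CkMap ℓ (Set.Icc (0 : Fin d → ℝ) 1) F →L[ℝ] CkMap ℓ (Set.univ : Set (Fin d → ℝ)) F,
      Function.RightInverse E (CkMap.restrict (Set.subset_univ (Set.Icc (0 : Fin d → ℝ) 1)))) := by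
  refine ⟨CkMap.exists_rightInverse_restrict_of_eq_pi _ (fun i => ?_) (orthant_eq_pi d m),
    CkMap.exists_rightInverse_restrict_of_eq_pi (fun _ => Set.Icc 0 1) (fun i => ?_)
      (Set.pi_univ_Icc _ _).symm⟩
  · split_ifs <;> simp
  · simp
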